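/- Let $\Omega\subseteq\mathbb{R}^3$ be open with compact boundary $\partial\Omega$, and suppose that $\Omega$ is a strong Lipschitz domain: for every $p\in\partial\Omega$ there are $\epsilon,h>0$, an orthonormal pair $w_1,w_2$ with a unit normal $v$ of $\operatorname{span}\{w_1,w_2\}$, and a Lipschitz function $a\colon B_\epsilon(0)\subseteq\mathbb{R}^2\to(-\tfrac h2,\tfrac h2)$ such that, with $\ell(x)=p+x_1w_1+x_2w_2$ and $C=\{\ell(x)+\delta v: |x|<\epsilon,\ |\delta|<h\}$, $$\partial\Omega\cap C=\{\ell(x)+a(x)v: |x|<\epsilon\},\qquad \Omega\cap C=\{\ell(x)+sv: |x|<\epsilon,\ -h<s<a(x)\}.$$ For each such choice and each non-empty open $U\subseteq B_\epsilon(0)$, the map $k^{-1}\colon U\to\Gamma:=k^{-1}(U)\subseteq\partial\Omega$, $k^{-1}(x)=\ell(x)+a(x)v$, is the inverse of a strong Lipschitz chart $k$. Let $L^2(\partial\Omega)$ (real or complex scalars) be taken with respect to the surface measure, given on $\Gamma$ by $\mu(\Upsilon)=\int_{k(\Upsilon)}\sqrt{\det((Dk^{-1})^{\top}Dk^{-1})}\,d\lambda_2$,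 and let $\nu$ be the unit normal with $\nu\circ k^{-1}=(1+\|\nabla a\|^2)^{-1/2}(-\partial_1a\,w_1-\partial_2a\,w_2+v)$ a.e. on $U$. Put $A^\dagger=(A^{\top}A)^{-1}A^{\top}$ and $L^2_\tau(\partial\Omega)=\{q\in L^2(\partial\Omega)^3:\nu\cdot q=0\text{ a.e.}\}$. * $H^1(\partial\Omega)$ is the set of all $f\in L^2(\partial\Omega)$ with $f\circ k^{-1}\in H^1(U)$ for every strong Lipschitz chart $k\colon\Gamma\to U$. The tangential gradient $\nabla_\tau f$ is defined by $(\nabla_\tau f)\circ k^{-1}=\big((Dk^{-1})^{\dagger}\big)^{\top}\nabla_{\mathbb{R}^2}(f\circ k^{-1})$ a.e. on $U$ for every such chart. * $\tilde H^1(\partial\Omega)$ is the set of all $f\in L^2(\partial\Omega)$ for which there is a $q\in L^2_\tau(\partial\Omega)$ with $$\langle q,\nu\times\Phi\rangle_{L^2(\partial\Omega)}=\langle f,\nu\cdot\operatorname{rot}\Phi\rangle_{L^2(\partial\Omega)}\qquad\text{for all }\Phi\in C_c^\infty(\mathbb{R}^3)^3;$$ such a $q$ is called the weak tangential gradient $\widetilde\nabla_\tau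 f$ of $f$. Then $H^1(\partial\Omega)\subseteq\tilde H^1(\partial\Omega)$. Moreover, for every $f\in H^1(\partial\Omega)$, both $\nabla_\tau f$ and $\widetilde\nabla_\tau f$ exist in $L^2(\partial\Omega)^3$ and are uniquely determined, and $\nabla_\tau f=\widetilde\nabla_\tau f$. -/

import Mathlib

open MeasureTheory
open scoped ContDiff

noncomputable section

namespace LipschitzBoundary

/-- The parameter plane `ℝ²` with the Euclidean norm. -/
abbrev Plane := EuclideanSpace ℝ (Fin 2)

/-- The ambient space `ℝ³` with the Euclidean norm. -/
abbrev Space := EuclideanSpace ℝ (Fin 3)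

/-! ### Strong Lipschitz domains and charts -/

/-- The point of the affine plane `p + span {w₀, w₁}` with coordinates `x`. -/
def planePoint (p : Space) (w : Fin 2 → Space) (x : Plane) : Space :=
  p + ∑ i, x i • w i

/-- The open cylinder of radius `ε` and half-height `h` around `p`, with base plane spanned by `w`
and axis `v`. -/
def cylinder (p : Space) (ε h : ℝ) (w : Fin 2 → Space) (v : Space) : Set Space :=
  {y | ∃ x ∈ Metric.ball (0 : Plane) ε, ∃ δ ∈ Set.Ioo (-h) h, y = planePoint p w x + δ • v}

/-- Inside the cylinder around the boundary point `p`, the boundary of `Ω` is the graph of the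
Lipschitz function `a` over the disc of radius `ε`, and `Ω` is the part below that graph.
The function `a` is written in the coordinates given by the orthonormal basis `w`; only its values
on the disc matter. -/
structure IsLipschitzPatch (Ω : Set Space) (p : Space) (ε h : ℝ) (w : Fin 2 → Space) (v : Space)
    (a : Plane → ℝ) : Prop where
  mem_frontier : p ∈ frontier Ω
  eps_pos : 0 < ε
  height_pos : 0 < h
  orthonormal : Orthonormal ℝ w
  norm_normal : ‖v‖ = 1
  inner_normal : ∀ i, inner ℝ (w i) v = 0
  lipschitz : ∃ K : NNReal, LipschitzOnWith K a (Metric.ball 0 ε)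
  abs_lt : ∀ x ∈ Metric.ball (0 : Plane) ε, |a x| < h / 2
  frontier_inter : frontier Ω ∩ cylinder p ε h w v =
    {y | ∃ x ∈ Metric.ball (0 : Plane) ε, y = planePoint p w x + a x • v}
  domain_inter : Ω ∩ cylinder p ε h w v =
    {y | ∃ x ∈ Metric.ball (0 : Plane) ε, ∃ s : ℝ, -h < s ∧ s < a x ∧
      y = planePoint p w x + s • v}

/-- Strong Lipschitz domains in `ℝ³`. -/
def IsStrongLipschitzDomain (Ω : Set Space) : Prop :=
  IsOpen Ω ∧ ∀ p ∈ frontier Ω, ∃ (ε h : ℝ) (w : Fin 2 → Space) (v : Space) (a : Plane → ℝ),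
    IsLipschitzPatch Ω p ε h w v a

/-- A strong Lipschitz chart of `∂Ω`, given by its inverse `k⁻¹ : U → ∂Ω`: a Lipschitz patch
together with a non-empty open subset `U` of the disc (restrictions of charts are charts). -/
structure Chart (Ω : Set Space) where
  p : Space
  ε : ℝ
  h : ℝ
  w : Fin 2 → Space
  v : Space
  a : Plane → ℝ
  isPatch : IsLipschitzPatch Ω p ε h w v a
  U : Set Plane
  isOpen_U : IsOpen U
  nonempty_U : U.Nonempty
  U_subset : U ⊆ Metric.ball 0 ε

namespace Chart

variable {Ω : Set Space} (c : Chart Ω)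

/-- The inverse chart `k⁻¹ x = p + x₀ w₀ + x₁ w₁ + a(x) v` (meaningful for `x ∈ U`). -/
def inv (x : Plane) : Space := planePoint c.p c.w x + c.a x • c.v

/-- The Jacobian matrix `D k⁻¹ (x)`, which exists for almost every `x ∈ U`. -/
def jacobian (x : Plane) : Matrix (Fin 3) (Fin 2) ℝ :=
  Matrix.of fun i j => (fderiv ℝ c.inv x (EuclideanSpace.single j 1)) i

/-- The surface element `√det((D k⁻¹)ᵀ D k⁻¹)`. -/
def areaElement (x : Plane) : ℝ :=
  Real.sqrt ((c.jacobian x).transpose * c.jacobian x).det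

/-- The surface measure on the chart domain `Γ = k⁻¹(U)`:
`Υ ↦ ∫_{k(Υ ∩ Γ)} √det((D k⁻¹)ᵀ D k⁻¹) dλ`. -/
def measure : Measure Space :=
  Measure.map c.inv
    ((volume.restrict c.U).withDensity fun x => ENNReal.ofReal (c.areaElement x))

/-- The partial derivative `∂ᵢ a`. -/
def slope (x : Plane) (i : Fin 2) : ℝ := fderiv ℝ c.a x (EuclideanSpace.single i 1)

/-- The unit normal `(1 + ‖∇a‖²)^(-1/2) (-∂₀a w₀ - ∂₁a w₁ + v)` at `k⁻¹ x`; it points out of `Ω`. -/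
def normal (x : Plane) : Space :=
  (Real.sqrt (1 + ∑ i, c.slope x i ^ 2))⁻¹ • (c.v - ∑ i, c.slope x i • c.w i)

end Chart

/-! ### Surface measure and normal vector -/

/-- The surface measure of `∂Ω`, as a measure on `ℝ³` that is concentrated on `∂Ω`. The measures of
two charts agree on the intersection of the chart domains, and the least measure above all of them
is the one obtained by gluing them along a partition of `∂Ω` into pieces of chart domains. -/
def surfaceMeasure (Ω : Set Space) : Measure Space := ⨆ c : Chart Ω, c.measure

/-- `n` is the normal at `ζ` computed in some chart around `ζ` whose graph function is
differentiable at the parameter of `ζ`. For given `ζ` there is at most one such `n`. -/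
def IsNormalAt (Ω : Set Space) (ζ n : Space) : Prop :=
  ∃ c : Chart Ω, ∃ x ∈ c.U, c.inv x = ζ ∧ DifferentiableAt ℝ c.a x ∧ n = c.normal x

open Classical in
/-- The unit normal vector field `ν` of `∂Ω`, defined almost everywhere on `∂Ω` (and `0` where no
chart yields a normal). -/
def unitNormal (Ω : Set Space) (ζ : Space) : Space :=
  if hn : ∃ n, IsNormalAt Ω ζ n then hn.choose else 0

section Spaces

variable (𝕜 : Type*) [RCLike 𝕜]

/-- The normal vector with its entries regarded as scalars in `𝕜`. -/
def unitNormalK (Ω : Set Space) (ζ : Space) : EuclideanSpace 𝕜 (Fin 3) :=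
  WithLp.toLp 2 fun i => ((unitNormal Ω ζ i : ℝ) : 𝕜)

/-- Scalar-valued `L²(∂Ω)`. -/
abbrev L2 (Ω : Set Space) := Lp 𝕜 2 (surfaceMeasure Ω)

/-- `L²(∂Ω)³`. -/
abbrev L2Vec (Ω : Set Space) := Lp (EuclideanSpace 𝕜 (Fin 3)) 2 (surfaceMeasure Ω)

variable {𝕜}

/-- The bilinear product `u · v = ∑ uᵢ vᵢ`. -/
def dot (u v : EuclideanSpace 𝕜 (Fin 3)) : 𝕜 := ∑ i, u i * v i

/-- The vector product `u × v`. -/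
def cross (u v : EuclideanSpace 𝕜 (Fin 3)) : EuclideanSpace 𝕜 (Fin 3) :=
  WithLp.toLp 2 (crossProduct u.ofLp v.ofLp)

/-- The partial derivative `∂ⱼ Φᵢ (y)`. -/
def partialDeriv (Φ : Space → EuclideanSpace 𝕜 (Fin 3)) (j i : Fin 3) (y : Space) : 𝕜 :=
  (fderiv ℝ Φ y (EuclideanSpace.single j 1)) i

/-- The rotation (curl) of a vector field. -/
def rot (Φ : Space → EuclideanSpace 𝕜 (Fin 3)) (y : Space) : EuclideanSpace 𝕜 (Fin 3) :=
  WithLp.toLp 2 ![partialDeriv Φ 1 2 y - partialDeriv Φ 2 1 y,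
    partialDeriv Φ 2 0 y - partialDeriv Φ 0 2 y,
    partialDeriv Φ 0 1 y - partialDeriv Φ 1 0 y]

/-! ### Sobolev functions on flat domains -/

/-- `u ∈ H¹(U)` with weak gradient `G`: both are square integrable on `U` and
`∫_U u ∂ᵢφ = -∫_U Gᵢ φ` for all `φ ∈ C_c^∞(U)`. -/
structure HasSobolevGradient (U : Set Plane) (u : Plane → 𝕜) (G : Plane → EuclideanSpace 𝕜 (Fin 2)) :
    Prop where
  memLp : MemLp u 2 (volume.restrict U)
  memLp_gradient : MemLp G 2 (volume.restrict U)
  integral_eq : ∀ φ : Plane → ℝ, ContDiff ℝ ∞ φ → HasCompactSupport φ → tsupport φ ⊆ U →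
    ∀ i : Fin 2, ∫ x in U, (fderiv ℝ φ x (EuclideanSpace.single i 1)) • u x =
      -∫ x in U, φ x • G x i

/-- `u ∈ H¹(U)`. -/
def MemSobolev (U : Set Plane) (u : Plane → 𝕜) : Prop := ∃ G, HasSobolevGradient U u G

/-! ### The two first order Sobolev spaces on the boundary -/

/-- The Moore-Penrose inverse `A† = (Aᵀ A)⁻¹ Aᵀ` of an injective matrix. -/
def pinv (A : Matrix (Fin 3) (Fin 2) ℝ) : Matrix (Fin 2) (Fin 3) ℝ :=
  (A.transpose * A)⁻¹ * A.transpose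

/-- The vector `(D k⁻¹(x)†)ᵀ g`. -/
def Chart.liftGradient {Ω : Set Space} (c : Chart Ω) (x : Plane) (g : EuclideanSpace 𝕜 (Fin 2)) :
    EuclideanSpace 𝕜 (Fin 3) :=
  WithLp.toLp 2
    (((pinv (c.jacobian x)).transpose.map fun r : ℝ => (r : 𝕜)).mulVec g.ofLp)

variable (𝕜) in
/-- The chart-defined space `H¹(∂Ω)`. -/
def H1 (Ω : Set Space) : Set (L2 𝕜 Ω) :=
  {f | ∀ c : Chart Ω, MemSobolev c.U fun x => f (c.inv x)}

/-- `q = ∇_τ f` in the sense of charts: in every chart `k`,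
`q ∘ k⁻¹ = ((D k⁻¹)†)ᵀ ∇(f ∘ k⁻¹)` almost everywhere on `U`. -/
def IsTangentialGradient {Ω : Set Space} (f : L2 𝕜 Ω) (q : L2Vec 𝕜 Ω) : Prop :=
  ∀ c : Chart Ω, ∃ G, HasSobolevGradient c.U (fun x => f (c.inv x)) G ∧
    ∀ᵐ x ∂(volume.restrict c.U), q (c.inv x) = c.liftGradient x (G x)

variable (𝕜) in
/-- The space `L²_τ(∂Ω)` of tangential square integrable vector fields. -/
def L2Tangential (Ω : Set Space) : Set (L2Vec 𝕜 Ω) :=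
  {q | ∀ᵐ ζ ∂(surfaceMeasure Ω), dot (unitNormalK 𝕜 Ω ζ) (q ζ) = 0}

/-- `q` is a weak tangential gradient of `f`: `q ∈ L²_τ(∂Ω)` and
`⟨q, ν × Φ⟩ = ⟨f, ν · rot Φ⟩` in `L²(∂Ω)` for all `Φ ∈ C_c^∞(ℝ³)³`. -/
def IsWeakTangentialGradient {Ω : Set Space} (f : L2 𝕜 Ω) (q : L2Vec 𝕜 Ω) : Prop :=
  q ∈ L2Tangential 𝕜 Ω ∧
  ∀ Φ : Space → EuclideanSpace 𝕜 (Fin 3), ContDiff ℝ ∞ Φ → HasCompactSupport Φ →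
    ∫ ζ, inner 𝕜 (q ζ) (cross (unitNormalK 𝕜 Ω ζ) (Φ ζ)) ∂(surfaceMeasure Ω) =
      ∫ ζ, inner 𝕜 (f ζ) (dot (unitNormalK 𝕜 Ω ζ) (rot Φ ζ)) ∂(surfaceMeasure Ω)

variable (𝕜) in
/-- The weakly defined space `H̃¹(∂Ω)`. -/
def weakH1 (Ω : Set Space) : Set (L2 𝕜 Ω) := {f | ∃ q, IsWeakTangentialGradient f q}

end Spaces

end LipschitzBoundary

end

/-! In one chart put t_j = ∂_j k⁻¹ = w_j + (∂_j a) v and N = v − ∑ (∂_i a) w_i. The area element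
times ν is N, and N = σ t₀ × t₁ with an orientation sign σ. For g = ∇(f ∘ k⁻¹) the lifted field Q =
((Dk⁻¹)†)ᵀ g is characterised by t_j · Q = g_j and N · Q = 0. For a test field Φ supported in the
chart, the weak identity therefore becomes an identity in the plane: the left side pairs the
conjugate of g with the functions t_j · Φ, and on the right N · rot Φ = σ (t₁ · ∂₀(Φ ∘ k⁻¹) − t₀ ·
∂₁(Φ ∘ k⁻¹)). This is an integration by parts with Lipschitz test functions. The coefficients ∂_j a
are merely bounded, but only the combination d(φ da) = dφ ∧ da occurs, in which second derivatives
of a cancel; mollification justifies it (`HasSobolevGradient.integral_wedge`). The outcome is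
`Chart.integral_chart`, and a smooth partition of unity makes it global
(`IsTangentialGradient.isWeakTangentialGradient`).

A tangential field is determined by its pairings with ν × Φ (`IsFinitelyCovered.ae_eq_zero`), so the
weak gradient is unique. The same statement, localised to an overlap of two charts, shows that the
lifts from both charts agree there (`Chart.ae_lifted_eq`): both solve the same weak problem, and no
transformation rule for Sobolev gradients is needed. Hence the lifts glue to a chart gradient. Every
chart gradient is a weak gradient, so it inherits uniqueness.

Two facts make the passage between surface and plane legitimate: the surface measure restricted to a
chart domain is the measure of that chart (`surfaceMeasure_restrict_surf`), and the normal does not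
depend on the chart (`Chart.normal_unique`). -/

noncomputable section

namespace LipschitzBoundary

open Set Filter Topology
open scoped Manifold

/-! ### Cylinder coordinates and first-order geometry of a single chart -/

section

namespace IsLipschitzPatch

variable {Ω : Set Space} {p : Space} {ε h : ℝ} {w : Fin 2 → Space} {v : Space} {a : Plane → ℝ}

lemma inner_base (hp : IsLipschitzPatch Ω p ε h w v a) (i j : Fin 2) :
    inner ℝ (w i) (w j) = if i = j then (1 : ℝ) else 0 :=
  orthonormal_iff_ite.mp hp.orthonormal i j

lemma inner_axis (hp : IsLipschitzPatch Ω p ε h w v a) : inner ℝ v v = (1 : ℝ) := by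
  rw [real_inner_self_eq_norm_sq, hp.norm_normal, one_pow]

lemma inner_axis_base (hp : IsLipschitzPatch Ω p ε h w v a) (i : Fin 2) :
    inner ℝ v (w i) = (0 : ℝ) := by
  rw [real_inner_comm, hp.inner_normal i]

lemma expansion (hp : IsLipschitzPatch Ω p ε h w v a) (y : Space) :
    y = ∑ i, (inner ℝ (w i) y : ℝ) • w i + (inner ℝ v y : ℝ) • v := by
  have ho : Orthonormal ℝ (![w 0, w 1, v] : Fin 3 → Space) := by
    rw [orthonormal_iff_ite]
    intro i j
    fin_cases i <;> fin_cases j <;>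
      simp [hp.inner_base, hp.inner_axis_base, hp.inner_normal, hp.norm_normal,
        hp.orthonormal.1]
  have hs : ⊤ ≤ Submodule.span ℝ (range (![w 0, w 1, v] : Fin 3 → Space)) := by
    rw [ho.linearIndependent.span_eq_top_of_card_eq_finrank (by simp)]
  have := (OrthonormalBasis.mk ho hs).sum_repr' y
  simpa [Fin.sum_univ_three, Fin.sum_univ_two] using this.symm

end IsLipschitzPatch

lemma planePoint_sub (p : Space) (w : Fin 2 → Space) (x x' : Plane) :
    planePoint p w x - planePoint p w x' = planePoint 0 w (x - x') := by
  simp [planePoint, sub_smul]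

namespace Chart

variable {Ω : Set Space} (c : Chart Ω)

/-- The coordinates of a point in the base plane of the chart. -/
def coords (y : Space) : Plane := WithLp.toLp 2 fun i => inner ℝ (c.w i) (y - c.p)

/-- The height of a point above the base plane of the chart. -/
def height (y : Space) : ℝ := inner ℝ c.v (y - c.p)

/-- The part of the cylinder of the chart that lies over the parameter domain. -/
def dom : Set Space := {y | c.coords y ∈ c.U ∧ c.height y ∈ Ioo (-c.h) c.h}

/-- The chart domain `Γ = k⁻¹(U)`. -/
def surf : Set Space := frontier Ω ∩ c.dom

lemma coords_apply (y : Space) (i : Fin 2) : c.coords y i = inner ℝ (c.w i) (y - c.p) := rfl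

lemma contDiff_coords : ContDiff ℝ ∞ c.coords := by
  rw [contDiff_euclidean]
  intro i
  exact contDiff_const.inner ℝ (contDiff_id.sub contDiff_const)

lemma contDiff_height : ContDiff ℝ ∞ c.height := by
  exact contDiff_const.inner ℝ (contDiff_id.sub contDiff_const)

lemma continuous_coords : Continuous c.coords := c.contDiff_coords.continuous

lemma continuous_height : Continuous c.height := c.contDiff_height.continuous

lemma isOpen_dom : IsOpen c.dom :=
  (c.isOpen_U.preimage c.continuous_coords).inter (isOpen_Ioo.preimage c.continuous_height)

lemma measurableSet_surf : MeasurableSet c.surf :=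
  isClosed_frontier.measurableSet.inter c.isOpen_dom.measurableSet

lemma coords_planePoint (x : Plane) (s : ℝ) : c.coords (planePoint c.p c.w x + s • c.v) = x := by
  ext i
  rw [coords_apply, planePoint]
  have : c.p + ∑ i, x i • c.w i + s • c.v - c.p = ∑ i, x i • c.w i + s • c.v := by abel
  rw [this, inner_add_right, inner_sum]
  simp only [inner_smul_right, c.isPatch.inner_base, c.isPatch.inner_normal]
  simp

lemma height_planePoint (x : Plane) (s : ℝ) : c.height (planePoint c.p c.w x + s • c.v) = s := by
  rw [height, planePoint]
  have : c.p + ∑ i, x i • c.w i + s • c.v - c.p = ∑ i, x i • c.w i + s • c.v := by abel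
  rw [this, inner_add_right, inner_sum]
  simp only [inner_smul_right, c.isPatch.inner_axis_base, c.isPatch.inner_axis]
  simp

lemma planePoint_coords (y : Space) :
    planePoint c.p c.w (c.coords y) + c.height y • c.v = y := by
  have := c.isPatch.expansion (y - c.p)
  rw [planePoint, add_assoc]
  simp only [coords_apply, height]
  rw [← this]
  abel

lemma mem_cylinder_iff (y : Space) :
    y ∈ cylinder c.p c.ε c.h c.w c.v ↔
      c.coords y ∈ Metric.ball (0 : Plane) c.ε ∧ c.height y ∈ Ioo (-c.h) c.h := by
  constructor
  · rintro ⟨x, hx, δ, hδ, rfl⟩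
    rw [coords_planePoint, height_planePoint]
    exact ⟨hx, hδ⟩
  · rintro ⟨h1, h2⟩
    exact ⟨_, h1, _, h2, (c.planePoint_coords y).symm⟩

lemma dom_subset_cylinder : c.dom ⊆ cylinder c.p c.ε c.h c.w c.v := fun y hy =>
  (c.mem_cylinder_iff y).mpr ⟨c.U_subset hy.1, hy.2⟩

@[simp] lemma coords_inv (x : Plane) : c.coords (c.inv x) = x := c.coords_planePoint _ _

@[simp] lemma height_inv (x : Plane) : c.height (c.inv x) = c.a x := c.height_planePoint _ _

lemma a_mem_Ioo {x : Plane} (hx : x ∈ Metric.ball (0 : Plane) c.ε) : c.a x ∈ Ioo (-c.h) c.h := by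
  have := abs_lt.mp (c.isPatch.abs_lt x hx)
  have := c.isPatch.height_pos
  constructor <;> linarith

lemma inv_mem_surf {x : Plane} (hx : x ∈ c.U) : c.inv x ∈ c.surf := by
  have h1 : c.inv x ∈ frontier Ω ∩ cylinder c.p c.ε c.h c.w c.v := by
    rw [c.isPatch.frontier_inter]
    exact ⟨x, c.U_subset hx, rfl⟩
  refine ⟨h1.1, ?_, ?_⟩
  · rwa [coords_inv]
  · rw [height_inv]
    exact c.a_mem_Ioo (c.U_subset hx)

lemma coords_mem {y : Space} (hy : y ∈ c.surf) : c.coords y ∈ c.U := hy.2.1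

lemma inv_coords {y : Space} (hy : y ∈ c.surf) : c.inv (c.coords y) = y := by
  have h1 : y ∈ frontier Ω ∩ cylinder c.p c.ε c.h c.w c.v := ⟨hy.1, c.dom_subset_cylinder hy.2⟩
  rw [c.isPatch.frontier_inter] at h1
  obtain ⟨x, _, rfl⟩ := h1
  rw [coords_planePoint]
  rfl

/-- Inside the cylinder, `Ω` is the set where the height is below the graph. -/
lemma mem_domain_iff {y : Space} (hy : y ∈ c.dom) : y ∈ Ω ↔ c.height y < c.a (c.coords y) := by
  have hc := c.dom_subset_cylinder hy
  constructor
  · intro h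
    have h1 : y ∈ Ω ∩ cylinder c.p c.ε c.h c.w c.v := ⟨h, hc⟩
    rw [c.isPatch.domain_inter] at h1
    obtain ⟨x, _, s, _, h3, rfl⟩ := h1
    rwa [coords_planePoint, height_planePoint]
  · intro h
    have h1 : y ∈ Ω ∩ cylinder c.p c.ε c.h c.w c.v := by
      rw [c.isPatch.domain_inter]
      exact ⟨_, c.U_subset hy.1, _, hy.2.1, h, (c.planePoint_coords y).symm⟩
    exact h1.1

/-! ### Derivatives in a chart -/

/-- The graph function is controlled on the disc only. A global extension gives a Lipschitz
parametrisation of the whole plane, to which Rademacher's theorem, mollification and continuity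
arguments apply directly. -/
lemma exists_lipschitz_extension :
    ∃ (K : NNReal) (b : Plane → ℝ), LipschitzWith K b ∧ EqOn c.a b (Metric.ball 0 c.ε) := by
  obtain ⟨K, hK⟩ := c.isPatch.lipschitz
  obtain ⟨b, hb, hab⟩ := hK.extend_real
  exact ⟨K, b, hb, hab⟩

/-- A globally Lipschitz extension of the graph function. -/
def ext : Plane → ℝ := c.exists_lipschitz_extension.choose_spec.choose

/-- The Lipschitz constant of the extension of the graph function. -/
def lip : NNReal := c.exists_lipschitz_extension.choose

lemma lipschitzWith_ext : LipschitzWith c.lip c.ext :=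
  c.exists_lipschitz_extension.choose_spec.choose_spec.1

lemma ext_eq {x : Plane} (hx : x ∈ c.U) : c.ext x = c.a x :=
  (c.exists_lipschitz_extension.choose_spec.choose_spec.2 (c.U_subset hx)).symm

lemma ext_eventuallyEq {x : Plane} (hx : x ∈ c.U) : c.ext =ᶠ[𝓝 x] c.a := by
  filter_upwards [c.isOpen_U.mem_nhds hx] with z hz using c.ext_eq hz

lemma differentiableAt_ext_iff {x : Plane} (hx : x ∈ c.U) :
    DifferentiableAt ℝ c.ext x ↔ DifferentiableAt ℝ c.a x :=
  (c.ext_eventuallyEq hx).differentiableAt_iff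

lemma ae_differentiableAt : ∀ᵐ x ∂(volume.restrict c.U), DifferentiableAt ℝ c.a x := by
  rw [ae_restrict_iff' c.isOpen_U.measurableSet]
  filter_upwards [c.lipschitzWith_ext.ae_differentiableAt] with x hx hU
  exact (c.differentiableAt_ext_iff hU).mp hx

lemma fderiv_ext {x : Plane} (hx : x ∈ c.U) : fderiv ℝ c.ext x = fderiv ℝ c.a x :=
  (c.ext_eventuallyEq hx).fderiv_eq

lemma abs_slope_le {x : Plane} (hx : x ∈ c.U) (i : Fin 2) : |c.slope x i| ≤ c.lip := by
  rw [slope, ← c.fderiv_ext hx, ← Real.norm_eq_abs]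
  refine (ContinuousLinearMap.le_opNorm _ _).trans ?_
  have := norm_fderiv_le_of_lipschitz ℝ c.lipschitzWith_ext (x₀ := x)
  simpa using this

/-- The globally Lipschitz extension of the inverse chart. -/
def invExt (x : Plane) : Space := planePoint c.p c.w x + c.ext x • c.v

lemma invExt_eq {x : Plane} (hx : x ∈ c.U) : c.invExt x = c.inv x := by
  rw [invExt, inv, c.ext_eq hx]

lemma norm_planePoint_zero (x : Plane) : ‖planePoint 0 c.w x‖ = ‖x‖ := by
  have h : ‖planePoint 0 c.w x‖ ^ 2 = ‖x‖ ^ 2 := by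
    rw [← real_inner_self_eq_norm_sq, EuclideanSpace.real_norm_sq_eq, planePoint]
    simp only [Fin.sum_univ_two, inner_add_left, inner_add_right, inner_smul_left,
      inner_smul_right, c.isPatch.inner_base, zero_add]
    simp
    ring
  exact (sq_eq_sq₀ (norm_nonneg _) (norm_nonneg _)).mp h

lemma lipschitzWith_invExt : LipschitzWith (1 + c.lip) c.invExt := by
  have h1 : LipschitzWith 1 (planePoint c.p c.w) := by
    refine LipschitzWith.of_dist_le_mul fun x y => ?_
    rw [dist_eq_norm, planePoint_sub, norm_planePoint_zero, dist_eq_norm]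
    simp
  refine h1.add (LipschitzWith.of_dist_le_mul fun x y => ?_)
  rw [dist_eq_norm, ← sub_smul, norm_smul, c.isPatch.norm_normal, mul_one, ← dist_eq_norm]
  exact c.lipschitzWith_ext.dist_le_mul x y

lemma lipschitzWith_coords : ∃ K, LipschitzWith K c.coords := by
  -- Linear part plus the constant `c.coords 0`, with the constant written so that the
  -- translation-invariance lemmas for `dist` remove it.
  have h : ∀ y, c.coords y =
      ContinuousLinearMap.comp (EuclideanSpace.equiv (Fin 2) ℝ).symm.toContinuousLinearMap
        (ContinuousLinearMap.pi fun i => innerSL ℝ (c.w i)) y - c.coords (0 : Space) +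
      (c.coords 0 + c.coords 0) := by
    intro y
    ext i
    simp [coords_apply, inner_add_right, sub_eq_add_neg]
  obtain ⟨K, hK⟩ : ∃ K, LipschitzWith K
      (ContinuousLinearMap.comp (EuclideanSpace.equiv (Fin 2) ℝ).symm.toContinuousLinearMap
        (ContinuousLinearMap.pi fun i => innerSL ℝ (c.w i))) :=
    ⟨_, ContinuousLinearMap.lipschitz _⟩
  refine ⟨K, LipschitzWith.of_dist_le_mul fun x y => ?_⟩
  rw [h x, h y, dist_add_right, dist_sub_right]
  exact hK.dist_le_mul x y

lemma continuousOn_inv : ContinuousOn c.inv c.U :=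
  c.lipschitzWith_invExt.continuous.continuousOn.congr fun _ hx => (c.invExt_eq hx).symm

lemma planePoint_hasFDerivAt (x : Plane) :
    HasFDerivAt (planePoint c.p c.w)
      (∑ i, (EuclideanSpace.proj i : Plane →L[ℝ] ℝ).smulRight (c.w i)) x := by
  unfold planePoint
  refine HasFDerivAt.const_add _ (HasFDerivAt.fun_sum fun i _ => ?_)
  exact HasFDerivAt.smul_const (EuclideanSpace.proj i : Plane →L[ℝ] ℝ).hasFDerivAt (c.w i)

lemma hasFDerivAt_inv {x : Plane} (hd : DifferentiableAt ℝ c.a x) :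
    HasFDerivAt c.inv (∑ i, (EuclideanSpace.proj i : Plane →L[ℝ] ℝ).smulRight (c.w i) +
      (fderiv ℝ c.a x).smulRight c.v) x :=
  (c.planePoint_hasFDerivAt x).add (hd.hasFDerivAt.smul_const c.v)

/-- The tangent vector `∂ⱼ k⁻¹ = wⱼ + (∂ⱼ a) v`. -/
def tangent (x : Plane) (j : Fin 2) : Space := c.w j + c.slope x j • c.v

/-- The normal vector `v - ∑ (∂ⱼ a) wⱼ` before normalisation. -/
def conormal (x : Plane) : Space := c.v - ∑ i, c.slope x i • c.w i

lemma fderiv_inv_single {x : Plane} (hd : DifferentiableAt ℝ c.a x) (j : Fin 2) :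
    fderiv ℝ c.inv x (EuclideanSpace.single j 1) = c.tangent x j := by
  rw [(c.hasFDerivAt_inv hd).fderiv, tangent, slope]
  fin_cases j <;> simp

lemma jacobian_apply {x : Plane} (hd : DifferentiableAt ℝ c.a x) (i : Fin 3) (j : Fin 2) :
    c.jacobian x i j = c.tangent x j i := by
  rw [jacobian, Matrix.of_apply, c.fderiv_inv_single hd]

lemma inner_tangent (x : Plane) (i j : Fin 2) :
    inner ℝ (c.tangent x i) (c.tangent x j) =
      (if i = j then 1 else 0) + c.slope x i * c.slope x j := by
  simp only [tangent, inner_add_left, inner_add_right, inner_smul_left, inner_smul_right,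
    c.isPatch.inner_base, c.isPatch.inner_axis, c.isPatch.inner_normal,
    c.isPatch.inner_axis_base]
  simp
  ring

lemma inner_conormal_tangent (x : Plane) (j : Fin 2) :
    inner ℝ (c.conormal x) (c.tangent x j) = (0 : ℝ) := by
  simp only [tangent, conormal, inner_add_right, inner_sub_left, sum_inner, inner_smul_left,
    inner_smul_right, c.isPatch.inner_base, c.isPatch.inner_axis, c.isPatch.inner_normal,
    c.isPatch.inner_axis_base]
  simp

lemma inner_conormal_self (x : Plane) :
    inner ℝ (c.conormal x) (c.conormal x) = 1 + ∑ i, c.slope x i ^ 2 := by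
  simp only [conormal, Fin.sum_univ_two, inner_sub_left, inner_sub_right, inner_add_left,
    inner_add_right, inner_smul_left,
    inner_smul_right, c.isPatch.inner_base, c.isPatch.inner_axis, c.isPatch.inner_normal,
    c.isPatch.inner_axis_base]
  simp
  ring

lemma gram_apply {x : Plane} (hd : DifferentiableAt ℝ c.a x) (i j : Fin 2) :
    ((c.jacobian x).transpose * c.jacobian x) i j =
      (if i = j then 1 else 0) + c.slope x i * c.slope x j := by
  rw [← c.inner_tangent, Matrix.mul_apply, PiLp.inner_apply]
  refine Finset.sum_congr rfl fun k _ => ?_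
  rw [Matrix.transpose_apply, c.jacobian_apply hd, c.jacobian_apply hd]
  simp [mul_comm]

/-- The Gram matrix is the rank-one perturbation I + ∇a ∇aᵀ of the identity. -/
lemma det_gram {x : Plane} (hd : DifferentiableAt ℝ c.a x) :
    ((c.jacobian x).transpose * c.jacobian x).det = 1 + ∑ i, c.slope x i ^ 2 := by
  rw [Matrix.det_fin_two]
  simp only [c.gram_apply hd, Fin.sum_univ_two]
  simp
  ring

lemma one_le_sq_sum (x : Plane) : 1 ≤ 1 + ∑ i, c.slope x i ^ 2 := by
  have : 0 ≤ ∑ i, c.slope x i ^ 2 := Finset.sum_nonneg fun i _ => sq_nonneg _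
  linarith

lemma areaElement_eq {x : Plane} (hd : DifferentiableAt ℝ c.a x) :
    c.areaElement x = Real.sqrt (1 + ∑ i, c.slope x i ^ 2) := by
  rw [areaElement, c.det_gram hd]

lemma areaElement_pos {x : Plane} (hd : DifferentiableAt ℝ c.a x) : 0 < c.areaElement x := by
  rw [c.areaElement_eq hd]
  exact Real.sqrt_pos.mpr (lt_of_lt_of_le one_pos (c.one_le_sq_sum x))

/-- The area element is exactly the normalising factor of ν. This removes all square roots from
surface integrals that are linear in the normal. -/
lemma areaElement_smul_normal {x : Plane} (hd : DifferentiableAt ℝ c.a x) :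
    c.areaElement x • c.normal x = c.conormal x := by
  have h := c.areaElement_pos hd
  rw [c.areaElement_eq hd] at h ⊢
  rw [normal, smul_smul, mul_inv_cancel₀ h.ne', one_smul]
  rfl

lemma normal_eq_smul (x : Plane) :
    c.normal x = (Real.sqrt (1 + ∑ i, c.slope x i ^ 2))⁻¹ • c.conormal x := rfl

lemma norm_conormal (x : Plane) : ‖c.conormal x‖ = Real.sqrt (1 + ∑ i, c.slope x i ^ 2) := by
  rw [norm_eq_sqrt_real_inner, inner_conormal_self]

lemma norm_normal_eq_one (x : Plane) : ‖c.normal x‖ = 1 := by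
  have h : 0 < Real.sqrt (1 + ∑ i, c.slope x i ^ 2) :=
    Real.sqrt_pos.mpr (lt_of_lt_of_le one_pos (c.one_le_sq_sum x))
  rw [normal_eq_smul, norm_smul, norm_conormal, norm_inv, Real.norm_of_nonneg h.le,
    inv_mul_cancel₀ h.ne']

lemma measurable_slope (i : Fin 2) : Measurable fun x => c.slope x i :=
  measurable_fderiv_apply_const ℝ c.a _

lemma measurable_jacobian (i : Fin 3) (j : Fin 2) : Measurable fun x => c.jacobian x i j := by
  simp only [jacobian, Matrix.of_apply]
  have := measurable_fderiv_apply_const ℝ c.inv (EuclideanSpace.single j (1 : ℝ))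
  fun_prop

lemma measurable_areaElement : Measurable c.areaElement := by
  have h (i j : Fin 2) : Measurable fun x => ((c.jacobian x).transpose * c.jacobian x) i j := by
    simp only [Matrix.mul_apply, Matrix.transpose_apply]
    exact Finset.measurable_sum _ fun k _ =>
      (c.measurable_jacobian k i).mul (c.measurable_jacobian k j)
  refine Real.continuous_sqrt.measurable.comp ?_
  simp only [Matrix.det_fin_two]
  exact ((h 0 0).mul (h 1 1)).sub ((h 0 1).mul (h 1 0))

lemma measurable_normal : Measurable c.normal := by
  have := c.measurable_slope
  unfold normal
  fun_prop

end Chart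

end

/-! ### Independence of the unit normal from the chart -/

section

/-- A function with a negative directional derivative at a zero becomes negative. -/
lemma eventually_neg_of_inner_neg {F : Space → ℝ} {ζ N z : Space}
    (hF : HasFDerivAt F (innerSL ℝ N) ζ) (h0 : F ζ = 0) (hz : inner ℝ N z < (0 : ℝ)) :
    ∀ᶠ t : ℝ in 𝓝[>] 0, F (ζ + t • z) < 0 := by
  have hline : HasDerivAt (fun t : ℝ => F (ζ + t • z)) (inner ℝ N z) 0 := by
    have h1 : HasDerivAt (fun t : ℝ => ζ + t • z) z 0 := by
      simpa using ((hasDerivAt_id (0 : ℝ)).smul_const z).const_add ζ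
    have h2 : HasFDerivAt F (innerSL ℝ N) (ζ + (0 : ℝ) • z) := by simpa using hF
    exact h2.comp_hasDerivAt (0 : ℝ) h1
  have hs := hasDerivAt_iff_tendsto_slope.mp hline
  have hs' := hs.mono_left (nhdsWithin_mono 0 (fun t (ht : 0 < t) => ht.ne' : Ioi (0 : ℝ) ⊆ {0}ᶜ))
  filter_upwards [hs'.eventually_lt_const hz, self_mem_nhdsWithin] with t ht htpos
  have htpos : 0 < t := htpos
  rw [slope_def_field] at ht
  simp only [zero_smul, add_zero, h0, sub_zero] at ht
  by_contra hcon
  exact absurd ht (not_lt.mpr (div_nonneg (not_lt.mp hcon) htpos.le))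

lemma inner_nonpos_of_eventually_neg {F : Space → ℝ} {ζ N z : Space}
    (hF : HasFDerivAt F (innerSL ℝ N) ζ) (h0 : F ζ = 0)
    (h : ∀ᶠ t : ℝ in 𝓝[>] 0, F (ζ + t • z) < 0) : inner ℝ N z ≤ (0 : ℝ) := by
  by_contra hcon
  have hn : HasFDerivAt (fun y => -F y) (innerSL ℝ (-N)) ζ := by
    rw [map_neg]
    exact hF.neg
  have := eventually_neg_of_inner_neg (F := fun y => -F y) (z := z) hn (by simp [h0])
    (by rw [inner_neg_left]; linarith)
  obtain ⟨t, h1, h2⟩ := (h.and this).exists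
  linarith

namespace Chart

variable {Ω : Set Space} (c : Chart Ω)

/-- Height minus graph function is a local defining function of Ω, and its gradient is the
unnormalised normal. -/
lemma hasFDerivAt_defining {ζ : Space} (hd : DifferentiableAt ℝ c.a (c.coords ζ)) :
    HasFDerivAt (fun y => c.height y - c.a (c.coords y))
      (innerSL ℝ (c.conormal (c.coords ζ))) ζ := by
  have h1 : HasFDerivAt c.height (innerSL ℝ c.v) ζ := by
    have : HasFDerivAt (fun y : Space => y - c.p) (ContinuousLinearMap.id ℝ Space) ζ :=
      (hasFDerivAt_id ζ).sub_const _
    exact (innerSL ℝ c.v).hasFDerivAt.comp ζ this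
  have h2 : HasFDerivAt c.coords ((EuclideanSpace.equiv (Fin 2) ℝ).symm.toContinuousLinearMap ∘L
      (ContinuousLinearMap.pi fun i => innerSL ℝ (c.w i))) ζ := by
    have h3 : HasFDerivAt (fun y : Space => y - c.p) (ContinuousLinearMap.id ℝ Space) ζ :=
      (hasFDerivAt_id ζ).sub_const _
    exact ((EuclideanSpace.equiv (Fin 2) ℝ).symm.toContinuousLinearMap ∘L
      (ContinuousLinearMap.pi fun i => innerSL ℝ (c.w i))).hasFDerivAt.comp ζ h3
  have h4 := h1.sub (hd.hasFDerivAt.comp ζ h2)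
  refine h4.congr_fderiv ?_
  ext z
  have hz : (WithLp.toLp 2 fun i => inner ℝ (c.w i) z : Plane) =
      ∑ i, (inner ℝ (c.w i) z : ℝ) • EuclideanSpace.single i (1 : ℝ) := by
    ext j
    fin_cases j <;> simp
  have key : fderiv ℝ c.a (c.coords ζ) (WithLp.toLp 2 fun i => inner ℝ (c.w i) z) =
      ∑ i, c.slope (c.coords ζ) i * inner ℝ (c.w i) z := by
    rw [hz, map_sum]
    refine Finset.sum_congr rfl fun i _ => ?_
    rw [map_smul, smul_eq_mul, mul_comm, slope]
  simp only [sub_apply, ContinuousLinearMap.comp_apply, innerSL_apply_apply,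
    conormal, inner_sub_left, sum_inner, inner_smul_left]
  rw [show ((EuclideanSpace.equiv (Fin 2) ℝ).symm.toContinuousLinearMap
    ((ContinuousLinearMap.pi fun i => innerSL ℝ (c.w i)) z)) =
      (WithLp.toLp 2 fun i => inner ℝ (c.w i) z : Plane) from rfl, key]
  simp

/-- The domain is locally the negativity set of the defining function of a chart. -/
lemma eventually_mem_domain_iff {ζ : Space} (hζ : ζ ∈ c.surf) (z : Space) :
    ∀ᶠ t : ℝ in 𝓝[>] 0, (ζ + t • z ∈ Ω ↔ c.height (ζ + t • z) - c.a (c.coords (ζ + t • z)) < 0) := by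
  have hc : Tendsto (fun t : ℝ => ζ + t • z) (𝓝[>] 0) (𝓝 ζ) := by
    have : Continuous fun t : ℝ => ζ + t • z := by fun_prop
    have h := (this.tendsto 0).mono_left (nhdsWithin_le_nhds (s := Ioi 0))
    simpa using h
  filter_upwards [hc.eventually_mem (c.isOpen_dom.mem_nhds hζ.2)] with t ht
  rw [c.mem_domain_iff ht, sub_neg]

/-- If the unit normals n, n' differ, then z = n' − n satisfies ⟨n, z⟩ < 0 < ⟨n', z⟩. By the first
inequality ζ + t z lies in Ω for small t > 0; by the second it cannot, because the defining function
of the other chart increases along z. That Ω lies below the graph in both charts is what excludes n'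
= −n. -/
lemma normal_unique (c c' : Chart Ω) {ζ : Space} (h : ζ ∈ c.surf) (h' : ζ ∈ c'.surf)
    (hd : DifferentiableAt ℝ c.a (c.coords ζ)) (hd' : DifferentiableAt ℝ c'.a (c'.coords ζ)) :
    c.normal (c.coords ζ) = c'.normal (c'.coords ζ) := by
  set n := c.normal (c.coords ζ) with hn
  set n' := c'.normal (c'.coords ζ) with hn'
  have n1 : ‖n‖ = 1 := c.norm_normal_eq_one _
  have n1' : ‖n'‖ = 1 := c'.norm_normal_eq_one _
  by_contra hne
  have hlt : inner ℝ n n' < (1 : ℝ) := inner_lt_one_iff_real_of_norm_eq_one n1 n1' |>.mpr hne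
  have z0 : c.height ζ - c.a (c.coords ζ) = 0 := by
    have := c.height_inv (c.coords ζ)
    rw [c.inv_coords h] at this
    rw [this, sub_self]
  have z0' : c'.height ζ - c'.a (c'.coords ζ) = 0 := by
    have := c'.height_inv (c'.coords ζ)
    rw [c'.inv_coords h'] at this
    rw [this, sub_self]
  have e1 := c.areaElement_smul_normal hd
  have e1' := c'.areaElement_smul_normal hd'
  have p1 := c.areaElement_pos hd
  have p1' := c'.areaElement_pos hd'
  have hneg : inner ℝ (c.conormal (c.coords ζ)) (n' - n) < (0 : ℝ) := by
    rw [← e1, inner_smul_left, inner_sub_right, ← hn, real_inner_self_eq_norm_sq, n1]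
    exact mul_neg_of_pos_of_neg p1 (by linarith)
  have h2 : inner ℝ (c'.conormal (c'.coords ζ)) (n' - n) ≤ (0 : ℝ) := by
    refine inner_nonpos_of_eventually_neg (c'.hasFDerivAt_defining hd') z0' ?_
    filter_upwards [eventually_neg_of_inner_neg (c.hasFDerivAt_defining hd) z0 hneg,
      c.eventually_mem_domain_iff h (n' - n), c'.eventually_mem_domain_iff h' (n' - n)]
      with t h3 h4 h5
    exact h5.mp (h4.mpr h3)
  rw [← e1', inner_smul_left, inner_sub_right, ← hn', real_inner_self_eq_norm_sq, n1',
    real_inner_comm n n'] at h2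
  have h3 : 0 < c'.areaElement (c'.coords ζ) * (1 ^ 2 - inner ℝ n n') :=
    mul_pos p1' (by linarith)
  simp only [conj_trivial] at h2
  linarith

/-- Makes the choice in the definition of `unitNormal` harmless: whichever chart is chosen, its
normal agrees with that of `c`. -/
lemma unitNormal_inv {x : Plane} (hx : x ∈ c.U) (hd : DifferentiableAt ℝ c.a x) :
    unitNormal Ω (c.inv x) = c.normal x := by
  have hex : ∃ n, IsNormalAt Ω (c.inv x) n := ⟨_, c, x, hx, rfl, hd, rfl⟩
  rw [unitNormal, dif_pos hex]
  obtain ⟨c', x', hx', hxx', hd', hn'⟩ := hex.choose_spec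
  rw [hn']
  have hs' : c.inv x ∈ c'.surf := hxx' ▸ c'.inv_mem_surf hx'
  have hc' : c'.coords (c.inv x) = x' := by rw [← hxx', coords_inv]
  have := normal_unique c c' (c.inv_mem_surf hx) hs' (by rwa [coords_inv]) (by rwa [hc'])
  rw [coords_inv, hc'] at this
  exact this.symm

lemma norm_unitNormal_le (ζ : Space) : ‖unitNormal Ω ζ‖ ≤ 1 := by
  rw [unitNormal]
  split_ifs with hn
  · obtain ⟨c, x, _, _, _, h⟩ := hn.choose_spec
    rw [h, c.norm_normal_eq_one]
  · simp

end Chart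

end

section

/-! ### Mollification of Lipschitz functions -/

/-- A sequence of bump functions shrinking to the origin. -/
def mollifier (n : ℕ) : ContDiffBump (0 : Plane) where
  rIn := 1 / (2 * ((n : ℝ) + 1))
  rOut := 1 / ((n : ℝ) + 1)
  rIn_pos := by positivity
  rIn_lt_rOut := by
    apply one_div_lt_one_div_of_lt <;> nlinarith [(Nat.cast_nonneg n : (0 : ℝ) ≤ n)]

/-- The convolution of `g` with the mollifying sequence. -/
def mollify (n : ℕ) (g : Plane → ℝ) (x : Plane) : ℝ :=
  ∫ t, (mollifier n).normed volume t * g (x - t)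

lemma mollify_eq_convolution (n : ℕ) (g : Plane → ℝ) :
    mollify n g = convolution ((mollifier n).normed volume) g (ContinuousLinearMap.lsmul ℝ ℝ)
      volume := rfl

variable {K : NNReal} {g : Plane → ℝ}

lemma tendsto_mollifier_rOut : Tendsto (fun n => (mollifier n).rOut) atTop (𝓝 0) :=
  tendsto_one_div_add_atTop_nhds_zero_nat

lemma contDiff_mollify (hg : Continuous g) (n : ℕ) : ContDiff ℝ ∞ (mollify n g) := by
  rw [mollify_eq_convolution]
  exact (mollifier n).hasCompactSupport_normed.contDiff_convolution_left _
    (mollifier n).contDiff_normed hg.locallyIntegrable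

lemma tendsto_mollify (hg : Continuous g) (x : Plane) :
    Tendsto (fun n => mollify n g x) atTop (𝓝 (g x)) := by
  simp_rw [mollify_eq_convolution]
  exact ContDiffBump.convolution_tendsto_right_of_continuous tendsto_mollifier_rOut hg x

lemma integrable_mollifier_mul (hg : Continuous g) (n : ℕ) (x : Plane) :
    Integrable fun t => (mollifier n).normed volume t * g (x - t) := by
  refine Continuous.integrable_of_hasCompactSupport ?_ ?_
  · exact (mollifier n).continuous_normed.mul (by fun_prop)
  · exact (mollifier n).hasCompactSupport_normed.mul_right

/-- The bump has integral one, so averaging keeps the Lipschitz constant. The derivatives of all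
mollifications thus share one bound, as dominated convergence will require. -/
lemma lipschitzWith_mollify (hg : LipschitzWith K g) (n : ℕ) : LipschitzWith K (mollify n g) := by
  refine LipschitzWith.of_dist_le_mul fun x y => ?_
  rw [Real.dist_eq, ← Real.norm_eq_abs, mollify, mollify, ← integral_sub (integrable_mollifier_mul hg.continuous n x)
    (integrable_mollifier_mul hg.continuous n y)]
  refine (norm_integral_le_of_norm_le (μ := (volume : Measure Plane))
    (g := fun t => (mollifier n).normed volume t * (K * dist x y))
    ((mollifier n).integrable_normed.mul_const _) (Eventually.of_forall fun t => ?_)).trans ?_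
  · rw [← mul_sub, norm_mul, Real.norm_of_nonneg ((mollifier n).nonneg_normed t)]
    refine mul_le_mul_of_nonneg_left ?_ ((mollifier n).nonneg_normed t)
    have := hg.dist_le_mul (x - t) (y - t)
    rwa [dist_sub_right] at this
  · rw [integral_mul_const, ContDiffBump.integral_normed, one_mul]

lemma ae_differentiableAt_sub (hg : LipschitzWith K g) (x : Plane) :
    ∀ᵐ t : Plane, DifferentiableAt ℝ g (x - t) := by
  have h := hg.ae_differentiableAt (μ := (volume : Measure Plane))
  exact (Measure.measurePreserving_sub_left volume x).quasiMeasurePreserving.ae h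

/-- Differentiation under the integral: the integrand is differentiable in x for almost every t by
Rademacher, and its difference quotients are dominated by K times the bump. -/
lemma fderiv_mollify (hg : LipschitzWith K g) (n : ℕ) (x : Plane) :
    fderiv ℝ (mollify n g) x = convolution ((mollifier n).normed volume) (fderiv ℝ g)
      (ContinuousLinearMap.lsmul ℝ ℝ) volume x := by
  have h := hasFDerivAt_integral_of_dominated_loc_of_lip' (μ := (volume : Measure Plane))
    (F := fun x t => (mollifier n).normed volume t * g (x - t))
    (F' := fun t => (mollifier n).normed volume t • fderiv ℝ g (x - t)) (x₀ := x)
    (bound := fun t => (mollifier n).normed volume t * K) (s := univ) univ_mem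
    (fun y _ => (integrable_mollifier_mul hg.continuous n y).aestronglyMeasurable)
    (integrable_mollifier_mul hg.continuous n x)
    (by
      have h1 : Measurable fun t => fderiv ℝ g (x - t) :=
        (measurable_fderiv ℝ g).comp (measurable_const.sub measurable_id)
      exact ((mollifier n).continuous_normed.aestronglyMeasurable).smul h1.aestronglyMeasurable)
    (Eventually.of_forall fun t y _ => by
      rw [← mul_sub, norm_mul, Real.norm_of_nonneg ((mollifier n).nonneg_normed t), mul_assoc]
      refine mul_le_mul_of_nonneg_left ?_ ((mollifier n).nonneg_normed t)
      have := hg.dist_le_mul (y - t) (x - t)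
      rwa [dist_sub_right, dist_eq_norm, dist_eq_norm] at this)
    ((mollifier n).integrable_normed.mul_const _)
    (by
      filter_upwards [ae_differentiableAt_sub hg x] with t ht
      have h1 : HasFDerivAt (fun y : Plane => y - t) (ContinuousLinearMap.id ℝ Plane) x :=
        (hasFDerivAt_id x).sub_const t
      exact (ht.hasFDerivAt.comp x h1).const_mul _)
  exact h.2.fderiv

lemma locallyIntegrable_fderiv (hg : LipschitzWith K g) :
    LocallyIntegrable (fderiv ℝ g) (volume : Measure Plane) :=
  (locallyIntegrable_const (K : ℝ)).mono (measurable_fderiv ℝ g).aestronglyMeasurable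
    (Eventually.of_forall fun x => by
      simpa using norm_fderiv_le_of_lipschitz ℝ hg)

lemma ae_tendsto_fderiv_mollify (hg : LipschitzWith K g) :
    ∀ᵐ x : Plane, Tendsto (fun n => fderiv ℝ (mollify n g) x) atTop (𝓝 (fderiv ℝ g x)) := by
  simp_rw [fderiv_mollify hg]
  -- Lebesgue differentiation needs the outer radii to be comparable to the inner ones; for
  -- `mollifier` the ratio is exactly 2.
  refine ContDiffBump.ae_convolution_tendsto_right_of_locallyIntegrable (K := 2)
    tendsto_mollifier_rOut (Eventually.of_forall fun n => ?_) (locallyIntegrable_fderiv hg)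
  have h : (0 : ℝ) < (n : ℝ) + 1 := by positivity
  change 1 / ((n : ℝ) + 1) ≤ 2 * (1 / (2 * ((n : ℝ) + 1)))
  rw [mul_one_div, mul_comm 2 ((n : ℝ) + 1), ← div_div, div_right_comm, div_self two_ne_zero]

lemma support_mollify_subset (n : ℕ) :
    Function.support (mollify n g) ⊆ Metric.cthickening (mollifier n).rOut (tsupport g) := by
  intro x hx
  rw [mollify_eq_convolution] at hx
  have h1 := support_convolution_subset_swap (ContinuousLinearMap.lsmul ℝ ℝ) hx
  obtain ⟨y, hy, t, ht, rfl⟩ := Set.mem_add.mp h1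
  rw [ContDiffBump.support_normed_eq] at ht
  refine Metric.mem_cthickening_of_dist_le _ y _ _ (subset_tsupport _ hy) ?_
  rw [dist_eq_norm, add_sub_cancel_left]
  exact (mem_ball_zero_iff.mp ht).le

lemma tsupport_mollify_subset (n : ℕ) :
    tsupport (mollify n g) ⊆ Metric.cthickening (mollifier n).rOut (tsupport g) :=
  closure_minimal (support_mollify_subset n) Metric.isClosed_cthickening

lemma eventually_tsupport_mollify_subset (hg : HasCompactSupport g) {U : Set Plane}
    (hU : IsOpen U) (hgU : tsupport g ⊆ U) :
    ∀ᶠ n in atTop, HasCompactSupport (mollify n g) ∧ tsupport (mollify n g) ⊆ U := by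
  obtain ⟨δ, hδ, hδU⟩ := IsCompact.exists_cthickening_subset_open hg hU hgU
  filter_upwards [tendsto_mollifier_rOut.eventually_lt_const hδ] with n hn
  have h1 := (tsupport_mollify_subset (g := g) n).trans (Metric.cthickening_mono hn.le _)
  exact ⟨IsCompact.of_isClosed_subset (IsCompact.cthickening hg) (isClosed_tsupport _) h1,
    h1.trans hδU⟩

end

section

/-! ### Integration by parts against Lipschitz functions in the plane -/

/-- The partial derivative of a function on the plane. -/
def partialPlane {F : Type*} [NormedAddCommGroup F] [NormedSpace ℝ F] (i : Fin 2) (f : Plane → F)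
    (x : Plane) : F := fderiv ℝ f x (EuclideanSpace.single i 1)

lemma partialPlane_mul {f g : Plane → ℝ} {x : Plane} (hf : DifferentiableAt ℝ f x)
    (hg : DifferentiableAt ℝ g x) (i : Fin 2) :
    partialPlane i (fun y => f y * g y) x = partialPlane i f x * g x + f x * partialPlane i g x := by
  simp only [partialPlane]
  rw [fderiv_fun_mul hf hg]
  simp
  ring

lemma contDiff_partialPlane {f : Plane → ℝ} (hf : ContDiff ℝ ∞ f) (i : Fin 2) :
    ContDiff ℝ ∞ (partialPlane i f) :=
  (hf.fderiv_right (m := ∞) (by simp)).clm_apply contDiff_const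

lemma partialPlane_comm {f : Plane → ℝ} (hf : ContDiff ℝ ∞ f) (i j : Fin 2) (x : Plane) :
    partialPlane i (partialPlane j f) x = partialPlane j (partialPlane i f) x := by
  have hd : DifferentiableAt ℝ (fderiv ℝ f) x :=
    ((hf.fderiv_right (m := 1) (by norm_cast)).differentiable one_ne_zero) x
  have key (i j : Fin 2) : partialPlane i (partialPlane j f) x =
      fderiv ℝ (fderiv ℝ f) x (EuclideanSpace.single i 1) (EuclideanSpace.single j 1) := by
    have : partialPlane j f = fun y => fderiv ℝ f y (EuclideanSpace.single j 1) := rfl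
    rw [partialPlane, this, fderiv_clm_apply hd (differentiableAt_const _)]
    simp
  rw [key, key]
  have hs : IsSymmSndFDerivAt ℝ f x := by
    refine (hf.contDiffAt (x := x)).isSymmSndFDerivAt ?_
    simp
    exact ENat.LEInfty.out
  exact hs _ _

lemma norm_partialPlane_le {F : Type*} [NormedAddCommGroup F] [NormedSpace ℝ F] {K : NNReal}
    {f : Plane → F} (hf : LipschitzWith K f) (i : Fin 2)
    (x : Plane) : ‖partialPlane i f x‖ ≤ K := by
  refine (ContinuousLinearMap.le_opNorm _ _).trans ?_
  simpa using norm_fderiv_le_of_lipschitz ℝ hf (x₀ := x)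

lemma measurable_partialPlane (f : Plane → ℝ) (i : Fin 2) : Measurable (partialPlane i f) :=
  measurable_fderiv_apply_const ℝ f _

lemma measurable_partialPlane' {𝕜 : Type*} [RCLike 𝕜] (f : Plane → 𝕜) (i : Fin 2) :
    Measurable (partialPlane i f) :=
  measurable_fderiv_apply_const ℝ f _

lemma aestronglyMeasurable_partialPlane {𝕜 : Type*} [RCLike 𝕜] (f : Plane → 𝕜) (i : Fin 2)
    (μ : Measure Plane) : AEStronglyMeasurable (partialPlane i f) μ :=
  (measurable_partialPlane' f i).aestronglyMeasurable

variable {𝕜 : Type*} [RCLike 𝕜] {U : Set Plane} {u : Plane → 𝕜}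
  {G : Plane → EuclideanSpace 𝕜 (Fin 2)}

lemma integrableOn_smul_of_continuous {f : Plane → ℝ} (hf : Continuous f)
    (hc : HasCompactSupport f) {g : Plane → 𝕜} (hg : IntegrableOn g U) :
    IntegrableOn (fun x => f x • g x) U := by
  obtain ⟨C, hC⟩ := hf.bounded_above_of_compact_support hc
  exact hg.bdd_smul C hf.aestronglyMeasurable (Eventually.of_forall hC)

lemma HasSobolevGradient.integrableOn (h : HasSobolevGradient U u G) (hU : volume U ≠ ⊤) :
    IntegrableOn u U := by
  have : IsFiniteMeasure (volume.restrict U) := ⟨by simpa using hU.lt_top⟩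
  exact h.memLp.integrable one_le_two

lemma HasSobolevGradient.integrableOn_gradient (h : HasSobolevGradient U u G)
    (hU : volume U ≠ ⊤) (i : Fin 2) : IntegrableOn (fun x => G x i) U := by
  have : IsFiniteMeasure (volume.restrict U) := ⟨by simpa using hU.lt_top⟩
  exact (h.memLp_gradient.eval_piLp i).integrable one_le_two

/-- Tests the Sobolev identity with φ ∂₁a in direction 0 and φ ∂₀a in direction 1 and subtracts. The
terms containing second derivatives of a cancel by symmetry. -/
lemma HasSobolevGradient.integral_wedge_smooth (h : HasSobolevGradient U u G) (hU : volume U ≠ ⊤)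
    {φ a : Plane → ℝ} (hφ : ContDiff ℝ ∞ φ) (hc : HasCompactSupport φ) (hs : tsupport φ ⊆ U)
    (ha : ContDiff ℝ ∞ a) :
    ∫ x in U, (partialPlane 0 φ x * partialPlane 1 a x -
        partialPlane 1 φ x * partialPlane 0 a x) • u x =
      ∫ x in U, ((φ x * partialPlane 0 a x) • G x 1 - (φ x * partialPlane 1 a x) • G x 0) := by
  have hu := h.integrableOn hU
  have key (i j : Fin 2) := h.integral_eq (fun x => φ x * partialPlane j a x)
    (hφ.mul (contDiff_partialPlane ha j)) hc.mul_right
    ((tsupport_mul_subset_left).trans hs) i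
  have hint (i j : Fin 2) : IntegrableOn (fun x => partialPlane i
      (fun x => φ x * partialPlane j a x) x • u x) U := by
    refine integrableOn_smul_of_continuous
      (contDiff_partialPlane (hφ.mul (contDiff_partialPlane ha j)) i).continuous ?_ hu
    exact (hc.mul_right).fderiv_apply ℝ _
  have hint' (i j : Fin 2) : IntegrableOn (fun x => (φ x * partialPlane j a x) • G x i) U :=
    integrableOn_smul_of_continuous (hφ.continuous.mul (contDiff_partialPlane ha j).continuous)
      hc.mul_right (h.integrableOn_gradient hU i)
  have e : ∀ x, (partialPlane 0 φ x * partialPlane 1 a x -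
        partialPlane 1 φ x * partialPlane 0 a x) • u x =
      partialPlane 0 (fun x => φ x * partialPlane 1 a x) x • u x -
      partialPlane 1 (fun x => φ x * partialPlane 0 a x) x • u x := by
    intro x
    have hφd : DifferentiableAt ℝ φ x := (hφ.differentiable (by simp)) x
    have had (i : Fin 2) : DifferentiableAt ℝ (partialPlane i a) x :=
      ((contDiff_partialPlane ha i).differentiable (by simp)) x
    rw [partialPlane_mul hφd (had 1), partialPlane_mul hφd (had 0), partialPlane_comm ha 0 1,
      ← sub_smul]
    congr 1
    ring
  simp_rw [e]
  rw [integral_sub (hint 0 1) (hint 1 0), integral_sub (hint' 1 0) (hint' 0 1)]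
  have k1 := key 0 1
  have k2 := key 1 0
  simp only [partialPlane] at k1 k2 ⊢
  rw [k1, k2]
  ring

lemma lipschitz_bound {K : NNReal} {φ : Plane → ℝ} (hφ : LipschitzWith K φ)
    (hc : HasCompactSupport φ) : ∃ C, ∀ x, ‖φ x‖ ≤ C :=
  hφ.continuous.bounded_above_of_compact_support hc

lemma norm_mollify_le {φ : Plane → ℝ} {C : ℝ} (hC : ∀ x, ‖φ x‖ ≤ C) (n : ℕ) (x : Plane) :
    ‖mollify n φ x‖ ≤ C := by
  refine (norm_integral_le_of_norm_le (g := fun t => (mollifier n).normed volume t * C)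
    ((mollifier n).integrable_normed.mul_const _) (Eventually.of_forall fun t => ?_)).trans ?_
  · rw [norm_mul, Real.norm_of_nonneg ((mollifier n).nonneg_normed t)]
    exact mul_le_mul_of_nonneg_left (hC _) ((mollifier n).nonneg_normed t)
  · rw [integral_mul_const, ContDiffBump.integral_normed, one_mul]

/-- Dominated convergence for bounded, almost everywhere convergent factors. -/
lemma tendsto_integral_smul_of_bounded {f : ℕ → Plane → ℝ} {f' : Plane → ℝ} {g : Plane → 𝕜}
    (hg : IntegrableOn g U) (hf : ∀ n, Measurable (f n)) {C : ℝ} (hC : ∀ n x, ‖f n x‖ ≤ C)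
    (hlim : ∀ᵐ x : Plane, Tendsto (fun n => f n x) atTop (𝓝 (f' x))) :
    Tendsto (fun n => ∫ x in U, f n x • g x) atTop (𝓝 (∫ x in U, f' x • g x)) := by
  refine tendsto_integral_of_dominated_convergence (fun x => C * ‖g x‖) (fun n => ?_) ?_
    (fun n => Eventually.of_forall fun x => ?_) ?_
  · exact (hf n).aestronglyMeasurable.smul hg.aestronglyMeasurable
  · exact hg.norm.const_mul C
  · rw [norm_smul]
    exact mul_le_mul_of_nonneg_right (hC n x) (norm_nonneg _)
  · filter_upwards [ae_restrict_of_ae hlim] with x hx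
    exact hx.smul_const _

/-- Both φ and a are mollified. The smooth identity contains only first derivatives, which are
uniformly bounded and converge almost everywhere, so it survives the limit although a has no second
derivatives. -/
lemma HasSobolevGradient.integral_wedge_real (h : HasSobolevGradient U u G) (hUo : IsOpen U)
    (hU : volume U ≠ ⊤) {K L : NNReal}
    {φ a : Plane → ℝ} (hφ : LipschitzWith K φ) (hc : HasCompactSupport φ) (hs : tsupport φ ⊆ U)
    (ha : LipschitzWith L a) :
    ∫ x in U, (partialPlane 0 φ x * partialPlane 1 a x -
        partialPlane 1 φ x * partialPlane 0 a x) • u x =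
      ∫ x in U, ((φ x * partialPlane 0 a x) • G x 1 - (φ x * partialPlane 1 a x) • G x 0) := by
  have hu := h.integrableOn hU
  have hG := h.integrableOn_gradient hU
  obtain ⟨C, hC⟩ := lipschitz_bound hφ hc
  have hC0 : 0 ≤ C := (norm_nonneg _).trans (hC 0)
  have bφ (n : ℕ) (i : Fin 2) (x : Plane) : ‖partialPlane i (mollify n φ) x‖ ≤ K :=
    norm_partialPlane_le (lipschitzWith_mollify hφ n) i x
  have ba (n : ℕ) (i : Fin 2) (x : Plane) : ‖partialPlane i (mollify n a) x‖ ≤ L :=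
    norm_partialPlane_le (lipschitzWith_mollify ha n) i x
  have bφ0 (n : ℕ) (x : Plane) : ‖mollify n φ x‖ ≤ C := norm_mollify_le hC n x
  have bb (n : ℕ) (i j : Fin 2) (x : Plane) :
      ‖partialPlane i (mollify n φ) x * partialPlane j (mollify n a) x‖ ≤ K * L := by
    rw [norm_mul]
    exact mul_le_mul (bφ n i x) (ba n j x) (norm_nonneg _) K.2
  have bb' (n : ℕ) (j : Fin 2) (x : Plane) :
      ‖mollify n φ x * partialPlane j (mollify n a) x‖ ≤ C * L := by
    rw [norm_mul]
    exact mul_le_mul (bφ0 n x) (ba n j x) (norm_nonneg _) hC0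
  have m1 (n : ℕ) : Measurable (mollify n φ) := (lipschitzWith_mollify hφ n).continuous.measurable
  have lim {f : Plane → ℝ} {K' : NNReal} (hf : LipschitzWith K' f) (i : Fin 2) : ∀ᵐ x : Plane,
      Tendsto (fun n => partialPlane i (mollify n f) x) atTop (𝓝 (partialPlane i f x)) := by
    filter_upwards [ae_tendsto_fderiv_mollify hf] with x hx
    exact ((ContinuousLinearMap.apply ℝ ℝ (EuclideanSpace.single i (1 : ℝ))).continuous.tendsto
      _).comp hx
  have t1 : Tendsto (fun n => ∫ x in U, (partialPlane 0 (mollify n φ) x *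
      partialPlane 1 (mollify n a) x - partialPlane 1 (mollify n φ) x *
      partialPlane 0 (mollify n a) x) • u x) atTop (𝓝 (∫ x in U, (partialPlane 0 φ x *
        partialPlane 1 a x - partialPlane 1 φ x * partialPlane 0 a x) • u x)) := by
    refine tendsto_integral_smul_of_bounded (C := K * L + K * L) hu
      (fun n => ((measurable_partialPlane _ _).mul (measurable_partialPlane _ _)).sub
        ((measurable_partialPlane _ _).mul (measurable_partialPlane _ _)))
      (fun n x => (norm_sub_le _ _).trans (add_le_add (bb n 0 1 x) (bb n 1 0 x))) ?_
    filter_upwards [lim hφ 0, lim hφ 1, lim ha 0, lim ha 1] with x h1 h2 h3 h4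
    exact (h1.mul h4).sub (h2.mul h3)
  have t2 (i j : Fin 2) : Tendsto (fun n => ∫ x in U, (mollify n φ x *
      partialPlane j (mollify n a) x) • G x i) atTop
      (𝓝 (∫ x in U, (φ x * partialPlane j a x) • G x i)) := by
    refine tendsto_integral_smul_of_bounded (C := C * L) (hG i)
      (fun n => (m1 n).mul (measurable_partialPlane _ _)) (fun n x => bb' n j x) ?_
    filter_upwards [lim ha j] with x h1
    exact (tendsto_mollify hφ.continuous x).mul h1
  have int2 (i j : Fin 2) {φ a : Plane → ℝ} {K' L' : NNReal} {C : ℝ} (hφ : LipschitzWith K' φ)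
      (ha : LipschitzWith L' a) (hC : ∀ x, ‖φ x‖ ≤ C) :
      IntegrableOn (fun x => (φ x * partialPlane j a x) • G x i) U := by
    refine (hG i).bdd_smul (C * L')
      (hφ.continuous.measurable.mul (measurable_partialPlane _ _)).aestronglyMeasurable
      (Eventually.of_forall fun x => ?_)
    rw [Pi.mul_apply, norm_mul]
    exact mul_le_mul (hC x) (norm_partialPlane_le ha j x) (norm_nonneg _)
      ((norm_nonneg _).trans (hC 0))
  refine tendsto_nhds_unique t1 ?_
  rw [integral_sub (int2 1 0 hφ ha hC) (int2 0 1 hφ ha hC)]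
  refine Tendsto.congr' ?_ ((t2 1 0).sub (t2 0 1))
  -- Mollification enlarges the support, so the smooth identity is available only once the enlarged
  -- support still fits into `U`.
  filter_upwards [eventually_tsupport_mollify_subset hc hUo hs] with n hn
  rw [← integral_sub (int2 1 0 (lipschitzWith_mollify hφ n) (lipschitzWith_mollify ha n) (bφ0 n))
      (int2 0 1 (lipschitzWith_mollify hφ n) (lipschitzWith_mollify ha n) (bφ0 n))]
  exact (h.integral_wedge_smooth hU (contDiff_mollify hφ.continuous n) hn.1 hn.2
    (contDiff_mollify ha.continuous n)).symm

/-- The weak form of `d(φ da) = dφ ∧ da`, tested with a Sobolev function. -/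
lemma HasSobolevGradient.integral_wedge (h : HasSobolevGradient U u G) (hUo : IsOpen U)
    (hU : volume U ≠ ⊤) {K L : NNReal}
    {φ : Plane → 𝕜} {a : Plane → ℝ} (hφ : LipschitzWith K φ) (hc : HasCompactSupport φ)
    (hs : tsupport φ ⊆ U) (ha : LipschitzWith L a) :
    ∫ x in U, (partialPlane 1 a x • partialPlane 0 φ x -
        partialPlane 0 a x • partialPlane 1 φ x) * u x =
      ∫ x in U, (φ x * (partialPlane 0 a x • G x 1) - φ x * (partialPlane 1 a x • G x 0)) := by
  have hu := h.integrableOn hU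
  have hG := h.integrableOn_gradient hU
  -- The real identity is applied to the real and imaginary parts of φ and recombined linearly.
  have lip (L : 𝕜 →L[ℝ] ℝ) : ∃ K', LipschitzWith K' (fun x => L (φ x)) :=
    ⟨_, L.lipschitz.comp hφ⟩
  have cpt (L : 𝕜 →L[ℝ] ℝ) : HasCompactSupport (fun x => L (φ x)) :=
    hc.comp_left (map_zero L)
  have sup (L : 𝕜 →L[ℝ] ℝ) : tsupport (fun x => L (φ x)) ⊆ U :=
    (closure_mono (Function.support_comp_subset (map_zero L) φ)).trans hs
  obtain ⟨K1, h1⟩ := lip RCLike.reCLM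
  obtain ⟨K2, h2⟩ := lip RCLike.imCLM
  have e1 := h.integral_wedge_real hUo hU h1 (cpt _) (sup _) ha
  have e2 := h.integral_wedge_real hUo hU h2 (cpt _) (sup _) ha
  have dφ : ∀ᵐ x ∂(volume.restrict U), ∀ i, partialPlane i φ x =
      ((partialPlane i (fun x => RCLike.reCLM (φ x)) x : ℝ) : 𝕜) +
      ((partialPlane i (fun x => RCLike.imCLM (φ x)) x : ℝ) : 𝕜) * RCLike.I := by
    filter_upwards [ae_restrict_of_ae (hφ.ae_differentiableAt (μ := volume))] with x hx i
    have hL (L : 𝕜 →L[ℝ] ℝ) : partialPlane i (fun x => L (φ x)) x = L (partialPlane i φ x) := by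
      have := (L.hasFDerivAt.comp x hx.hasFDerivAt).fderiv
      rw [partialPlane, show (fun x => L (φ x)) = L ∘ φ from rfl, this]
      rfl
    rw [hL, hL]
    exact (RCLike.re_add_im _).symm
  have intL {f : Plane → ℝ} {K' : NNReal} (hf : LipschitzWith K' f) : IntegrableOn (fun x =>
      (partialPlane 0 f x * partialPlane 1 a x -
        partialPlane 1 f x * partialPlane 0 a x) • u x) U := by
    refine hu.bdd_smul (K' * L + K' * L) ((((measurable_partialPlane _ _).mul
      (measurable_partialPlane _ _)).sub ((measurable_partialPlane _ _).mul
        (measurable_partialPlane _ _)))).aestronglyMeasurable (Eventually.of_forall fun x => ?_)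
    refine (norm_sub_le _ _).trans (add_le_add ?_ ?_) <;> rw [Pi.mul_apply, norm_mul] <;>
      exact mul_le_mul (norm_partialPlane_le hf _ x) (norm_partialPlane_le ha _ x)
        (norm_nonneg _) K'.2
  have intR {f : Plane → ℝ} {K' : NNReal} (hf : LipschitzWith K' f) (hfc : HasCompactSupport f) :
      IntegrableOn (fun x =>
      (f x * partialPlane 0 a x) • G x 1 - (f x * partialPlane 1 a x) • G x 0) U := by
    obtain ⟨C, hC⟩ := lipschitz_bound hf hfc
    have (i j : Fin 2) : IntegrableOn (fun x => (f x * partialPlane j a x) • G x i) U := by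
      refine (hG i).bdd_smul (C * L)
        (hf.continuous.measurable.mul (measurable_partialPlane _ _)).aestronglyMeasurable
        (Eventually.of_forall fun x => ?_)
      rw [Pi.mul_apply, norm_mul]
      exact mul_le_mul (hC x) (norm_partialPlane_le ha j x) (norm_nonneg _)
        ((norm_nonneg _).trans (hC 0))
    exact (this 1 0).sub (this 0 1)
  calc _ = ∫ x in U, (((partialPlane 0 (fun x => RCLike.reCLM (φ x)) x * partialPlane 1 a x -
          partialPlane 1 (fun x => RCLike.reCLM (φ x)) x * partialPlane 0 a x) • u x) +
        ((partialPlane 0 (fun x => RCLike.imCLM (φ x)) x * partialPlane 1 a x -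
          partialPlane 1 (fun x => RCLike.imCLM (φ x)) x * partialPlane 0 a x) • u x) *
          RCLike.I) := by
        refine integral_congr_ae ?_
        filter_upwards [dφ] with x hx
        rw [hx 0, hx 1]
        simp only [RCLike.real_smul_eq_coe_mul]
        push_cast
        ring
    _ = ∫ x in U, (((RCLike.reCLM (φ x) * partialPlane 0 a x) • G x 1 -
          (RCLike.reCLM (φ x) * partialPlane 1 a x) • G x 0) +
          ((RCLike.imCLM (φ x) * partialPlane 0 a x) • G x 1 -
          (RCLike.imCLM (φ x) * partialPlane 1 a x) • G x 0) * RCLike.I) := by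
        rw [integral_add (intL h1) ((intL h2).mul_const _),
          integral_add (intR h1 (cpt _)) ((intR h2 (cpt _)).mul_const _),
          integral_mul_const, integral_mul_const, e1, e2]
    _ = _ := by
        refine integral_congr_ae (Eventually.of_forall fun x => ?_)
        simp only [RCLike.real_smul_eq_coe_mul, RCLike.reCLM_apply, RCLike.imCLM_apply]
        conv_rhs => rw [← RCLike.re_add_im (φ x)]
        push_cast
        ring

/-- Partial integration with Lipschitz test functions. -/
lemma HasSobolevGradient.integral_partialPlane (h : HasSobolevGradient U u G) (hUo : IsOpen U)
    (hU : volume U ≠ ⊤) {K : NNReal} {φ : Plane → 𝕜} (hφ : LipschitzWith K φ)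
    (hc : HasCompactSupport φ) (hs : tsupport φ ⊆ U) :
    (∫ x in U, partialPlane 0 φ x * u x = -∫ x in U, φ x * G x 0) ∧
      ∫ x in U, partialPlane 1 φ x * u x = -∫ x in U, φ x * G x 1 := by
  -- With a coordinate function in place of a, the wedge identity collapses to a single partial
  -- derivative.
  have hp (i j : Fin 2) (x : Plane) : partialPlane i (fun y : Plane => y j) x =
      if i = j then 1 else 0 := by
    have : fderiv ℝ (fun y : Plane => y j) x = EuclideanSpace.proj j :=
      (EuclideanSpace.proj j : Plane →L[ℝ] ℝ).fderiv
    rw [partialPlane, this]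
    fin_cases i <;> fin_cases j <;> simp
  have hl (j : Fin 2) : LipschitzWith _ (fun y : Plane => y j) :=
    (EuclideanSpace.proj j : Plane →L[ℝ] ℝ).lipschitz
  have e0 := h.integral_wedge hUo hU hφ hc hs (hl 1)
  have e1 := h.integral_wedge hUo hU hφ hc hs (hl 0)
  simp only [hp] at e0 e1
  constructor
  · simpa [integral_neg] using e0
  · have e1' : ∫ x in U, -(partialPlane 1 φ x * u x) = ∫ x in U, φ x * G x 1 := by
      simpa using e1
    rw [← e1', integral_neg, neg_neg]

/-- Complex conjugation of a Sobolev function. -/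
lemma HasSobolevGradient.conj (h : HasSobolevGradient U u G) :
    HasSobolevGradient U (fun x => starRingEnd 𝕜 (u x))
      (fun x => WithLp.toLp 2 fun i => starRingEnd 𝕜 (G x i)) where
  memLp := h.memLp.star
  memLp_gradient := MemLp.of_eval_piLp fun i => (h.memLp_gradient.eval_piLp i).star
  integral_eq φ h1 h2 h3 i := by
    have e := congrArg (starRingEnd 𝕜) (h.integral_eq φ h1 h2 h3 i)
    rw [map_neg, ← integral_conj, ← integral_conj] at e
    simpa [RCLike.real_smul_eq_coe_mul] using e

end

/-! ### Transition maps and agreement of the chart measures -/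

section

/-- Lebesgue measure and two-dimensional Hausdorff measure have the same null sets, and a Lipschitz
map enlarges the latter by at most a constant factor. -/
lemma volume_image_eq_zero {K : NNReal} {T : Plane → Plane} (hT : LipschitzWith K T) {s : Set Plane}
    (hs : volume s = 0) : volume (T '' s) = 0 := by
  have h1 : (Measure.hausdorffMeasure (2 : ℕ) : Measure Plane) ≪ volume :=
    Measure.absolutelyContinuous_isAddHaarMeasure _ _
  have h2 : (volume : Measure Plane) ≪ Measure.hausdorffMeasure (2 : ℕ) :=
    Measure.absolutelyContinuous_isAddHaarMeasure _ _
  refine h2 (nonpos_iff_eq_zero.mp ?_)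
  refine (hT.hausdorffMeasure_image_le (Nat.cast_nonneg 2) s).trans ?_
  rw [h1 hs, mul_zero]

namespace Chart

variable {Ω : Set Space} (c c' : Chart Ω)

lemma continuous_invExt : Continuous c.invExt := c.lipschitzWith_invExt.continuous

lemma inv_ae_eq_invExt : c.inv =ᵐ[(volume.restrict c.U).withDensity
    fun x => ENNReal.ofReal (c.areaElement x)] c.invExt := by
  refine withDensity_absolutelyContinuous _ _ ?_
  filter_upwards [ae_restrict_mem c.isOpen_U.measurableSet] with x hx
  exact (c.invExt_eq hx).symm

/-- `c.inv` is arbitrary off the disc and need not be measurable, whereas `c.invExt` is continuous.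
This form makes the preimage formula for `Measure.map` usable. -/
lemma measure_eq_map_invExt : c.measure = Measure.map c.invExt
    ((volume.restrict c.U).withDensity fun x => ENNReal.ofReal (c.areaElement x)) :=
  Measure.map_congr c.inv_ae_eq_invExt

lemma measure_apply {A : Set Space} (hA : MeasurableSet A) :
    c.measure A = ∫⁻ x in c.invExt ⁻¹' A ∩ c.U, ENNReal.ofReal (c.areaElement x) := by
  have hm : MeasurableSet (c.invExt ⁻¹' A) := c.continuous_invExt.measurable hA
  rw [measure_eq_map_invExt, Measure.map_apply c.continuous_invExt.measurable hA,
    withDensity_apply _ hm, Measure.restrict_restrict hm]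

/-- The change of coordinates from one chart to another. -/
def transition (x : Plane) : Plane := c'.coords (c.invExt x)

lemma exists_lipschitzWith_transition : ∃ K, LipschitzWith K (c.transition c') := by
  obtain ⟨K, hK⟩ := c'.lipschitzWith_coords
  exact ⟨_, hK.comp c.lipschitzWith_invExt⟩

lemma transition_eq {x : Plane} (hx : x ∈ c.U) : c.transition c' x = c'.coords (c.inv x) := by
  rw [transition, c.invExt_eq hx]

lemma inv_transition {x : Plane} (hx : x ∈ c.U) (h : c.inv x ∈ c'.surf) :
    c'.inv (c.transition c' x) = c.inv x := by
  rw [c.transition_eq c' hx, c'.inv_coords h]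

lemma transition_mem {x : Plane} (hx : x ∈ c.U) (h : c.inv x ∈ c'.surf) :
    c.transition c' x ∈ c'.U := by
  rw [c.transition_eq c' hx]
  exact c'.coords_mem h

lemma transition_transition {x : Plane} (hx : x ∈ c.U) (h : c.inv x ∈ c'.surf) :
    c'.transition c (c.transition c' x) = x := by
  rw [c'.transition_eq c (c.transition_mem c' hx h), c.inv_transition c' hx h, coords_inv]

lemma eventually_inv_mem_surf {x : Plane} (hx : x ∈ c.U) (h : c.inv x ∈ c'.surf) :
    ∀ᶠ y in 𝓝 x, y ∈ c.U ∧ c.inv y ∈ c'.surf := by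
  have hcont : ContinuousAt c.inv x := c.continuousOn_inv.continuousAt (c.isOpen_U.mem_nhds hx)
  filter_upwards [c.isOpen_U.mem_nhds hx, hcont.eventually_mem (c'.isOpen_dom.mem_nhds h.2)]
    with y hy hy'
  exact ⟨hy, (c.inv_mem_surf hy).1, hy'⟩

lemma differentiableAt_transition {x : Plane} (hx : x ∈ c.U) (hd : DifferentiableAt ℝ c.a x) :
    DifferentiableAt ℝ (c.transition c') x := by
  have h1 : c.transition c' =ᶠ[𝓝 x] fun y => c'.coords (c.inv y) := by
    filter_upwards [c.isOpen_U.mem_nhds hx] with y hy using c.transition_eq c' hy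
  rw [h1.differentiableAt_iff]
  exact ((c'.contDiff_coords.differentiable (by simp)) _).comp x
    (c.hasFDerivAt_inv hd).differentiableAt

/-- Near x the parametrisations satisfy k⁻¹ = k'⁻¹ ∘ T. By the chain rule J = J' M with M the matrix
of DT, so det(JᵀJ) = (det M)² det(J'ᵀJ'). -/
lemma areaElement_transition {x : Plane} (hx : x ∈ c.U) (h : c.inv x ∈ c'.surf)
    (hd : DifferentiableAt ℝ c.a x) (hd' : DifferentiableAt ℝ c'.a (c.transition c' x)) :
    c.areaElement x =
      |(fderiv ℝ (c.transition c') x).det| * c'.areaElement (c.transition c' x) := by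
  set L := fderiv ℝ (c.transition c') x with hL
  have hev : c.inv =ᶠ[𝓝 x] c'.inv ∘ c.transition c' := by
    filter_upwards [c.eventually_inv_mem_surf c' hx h] with y hy
    exact (c.inv_transition c' hy.1 hy.2).symm
  have hchain : fderiv ℝ c.inv x = (fderiv ℝ c'.inv (c.transition c' x)).comp L := by
    rw [hev.fderiv_eq]
    exact ((c'.hasFDerivAt_inv hd').differentiableAt.hasFDerivAt.comp x
      (c.differentiableAt_transition c' hx hd).hasFDerivAt).fderiv
  let M : Matrix (Fin 2) (Fin 2) ℝ := LinearMap.toMatrix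
    (EuclideanSpace.basisFun (Fin 2) ℝ).toBasis (EuclideanSpace.basisFun (Fin 2) ℝ).toBasis
    (L : Plane →ₗ[ℝ] Plane)
  have hM (i j : Fin 2) : M i j = L (EuclideanSpace.single j 1) i := by
    simp [M, LinearMap.toMatrix_apply]
  have hdet : M.det = L.det := LinearMap.det_toMatrix _ _
  have hJ : c.jacobian x = c'.jacobian (c.transition c' x) * M := by
    ext i j
    rw [Matrix.mul_apply]
    have hexp : L (EuclideanSpace.single j 1) = ∑ k, M k j • EuclideanSpace.single k (1 : ℝ) := by
      ext k
      simp only [hM]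
      fin_cases k <;> simp
    simp only [jacobian, Matrix.of_apply]
    rw [hchain, ContinuousLinearMap.comp_apply, hexp, map_sum]
    simp [mul_comm]
  rw [areaElement, areaElement, hJ, ← hdet, ← Real.sqrt_sq_eq_abs, ← Real.sqrt_mul (sq_nonneg _)]
  congr 1
  rw [Matrix.transpose_mul, Matrix.mul_assoc, ← Matrix.mul_assoc _ _ M, Matrix.det_mul,
    Matrix.det_mul _ M, Matrix.det_transpose]
  ring

/-- The set of parameters in `A` at which two charts are differentiable. -/
def regularSet (A : Set Space) : Set Plane :=
  {x | x ∈ c.invExt ⁻¹' A ∩ c.U ∧ DifferentiableAt ℝ c.a x ∧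
    DifferentiableAt ℝ c'.a (c.transition c' x)}

variable {A : Set Space}

lemma measurableSet_regularSet (hA : MeasurableSet A) : MeasurableSet (c.regularSet c' A) := by
  obtain ⟨K, hK⟩ := c.exists_lipschitzWith_transition c'
  refine ((c.continuous_invExt.measurable hA).inter c.isOpen_U.measurableSet).inter
    ((measurableSet_of_differentiableAt ℝ c.a).inter ?_)
  exact hK.continuous.measurable (measurableSet_of_differentiableAt ℝ c'.a)

lemma image_regularSet_subset (hA : A ⊆ c.surf ∩ c'.surf) :
    c.transition c' '' c.regularSet c' A ⊆ c'.regularSet c A := by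
  rintro _ ⟨x, ⟨⟨hxA, hxU⟩, hd, hd'⟩, rfl⟩
  have hxA' : c.inv x ∈ A := by
    rw [← c.invExt_eq hxU]
    exact hxA
  have hs := (hA hxA').2
  refine ⟨⟨?_, c.transition_mem c' hxU hs⟩, hd', ?_⟩
  · rw [mem_preimage, c'.invExt_eq (c.transition_mem c' hxU hs), c.inv_transition c' hxU hs]
    exact hxA'
  · rwa [c.transition_transition c' hxU hs]

/-- The inclusion is symmetric in the two charts, and the transition maps are mutually inverse over
the overlap. -/
lemma image_regularSet (hA : A ⊆ c.surf ∩ c'.surf) :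
    c.transition c' '' c.regularSet c' A = c'.regularSet c A := by
  refine (c.image_regularSet_subset c' hA).antisymm fun x' hx' => ?_
  have h := c'.image_regularSet_subset c (by rwa [inter_comm]) (mem_image_of_mem _ hx')
  refine ⟨_, h, ?_⟩
  refine c'.transition_transition c hx'.1.2 ?_
  rw [← c'.invExt_eq hx'.1.2]
  exact (hA hx'.1.1).1

/-- Rademacher handles the first graph function. A parameter where the second one fails to be
differentiable is the image, under the Lipschitz transition back, of a point in a null set of the
second chart. -/
lemma regularSet_ae_eq (hA : A ⊆ c.surf ∩ c'.surf) :
    c.regularSet c' A =ᵐ[volume] (c.invExt ⁻¹' A ∩ c.U : Set Plane) := by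
  have h1 : ∀ᵐ x : Plane, x ∈ c.U → DifferentiableAt ℝ c.a x :=
    (ae_restrict_iff' c.isOpen_U.measurableSet).mp c.ae_differentiableAt
  have h2 : ∀ᵐ x : Plane, x ∈ c'.U → DifferentiableAt ℝ c'.a x :=
    (ae_restrict_iff' c'.isOpen_U.measurableSet).mp c'.ae_differentiableAt
  obtain ⟨K, hK⟩ := c'.exists_lipschitzWith_transition c
  have h3 : ∀ᵐ x : Plane, x ∉ c'.transition c '' {x | ¬(x ∈ c'.U → DifferentiableAt ℝ c'.a x)} :=
    measure_eq_zero_iff_ae_notMem.mp (volume_image_eq_zero hK h2)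
  filter_upwards [h1, h3] with x hx hx'
  refine propext ⟨fun h => h.1, fun h => ⟨h, hx h.2, ?_⟩⟩
  by_contra hcon
  have hs : c.inv x ∈ c'.surf := by
    rw [← c.invExt_eq h.2]
    exact (hA h.1).2
  refine hx' ⟨c.transition c' x, ?_, c.transition_transition c' h.2 hs⟩
  simp only [mem_ofPred_eq, Classical.not_imp]
  exact ⟨c.transition_mem c' h.2 hs, hcon⟩

/-- Change of variables along the transition map, whose Jacobian is the quotient of the area
elements. It is carried out on the regular sets, which are exchanged by the transition and miss only
null sets. -/
lemma measure_eq_of_subset_inter (hAm : MeasurableSet A) (hA : A ⊆ c.surf ∩ c'.surf) :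
    c.measure A = c'.measure A := by
  rw [measure_apply c hAm, measure_apply c' hAm, ← setLIntegral_congr (c.regularSet_ae_eq c' hA),
    ← setLIntegral_congr (c'.regularSet_ae_eq c (by rwa [inter_comm])),
    ← c.image_regularSet c' hA,
    lintegral_image_eq_lintegral_abs_det_fderiv_mul volume (c.measurableSet_regularSet c' hAm)
      (f := c.transition c') (f' := fun x => fderiv ℝ (c.transition c') x)
      (fun x hx => (c.differentiableAt_transition c' hx.1.2 hx.2.1).hasFDerivAt.hasFDerivWithinAt)]
  · refine setLIntegral_congr_fun (c.measurableSet_regularSet c' hAm) fun x hx => ?_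
    have hs : c.inv x ∈ c'.surf := by
      rw [← c.invExt_eq hx.1.2]
      exact (hA hx.1.1).2
    rw [← ENNReal.ofReal_mul (abs_nonneg _), c.areaElement_transition c' hx.1.2 hs hx.2.1 hx.2.2]
  · intro x hx y hy hxy
    have hs (z : Plane) (hz : z ∈ c.regularSet c' A) : c.inv z ∈ c'.surf := by
      rw [← c.invExt_eq hz.1.2]
      exact (hA hz.1.1).2
    rw [← c.transition_transition c' hx.1.2 (hs x hx), hxy,
      c.transition_transition c' hy.1.2 (hs y hy)]

lemma measure_compl_surf : c.measure c.surfᶜ = 0 := by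
  rw [c.measure_apply c.measurableSet_surf.compl]
  have : c.invExt ⁻¹' c.surfᶜ ∩ c.U = ∅ := by
    refine eq_empty_of_forall_notMem fun x hx => hx.1 ?_
    rw [c.invExt_eq hx.2]
    exact c.inv_mem_surf hx.2
  rw [this]
  simp

lemma areaElement_le {x : Plane} (hx : x ∈ c.U) (hd : DifferentiableAt ℝ c.a x) :
    c.areaElement x ≤ Real.sqrt (1 + 2 * (c.lip : ℝ) ^ 2) := by
  rw [c.areaElement_eq hd]
  refine Real.sqrt_le_sqrt ?_
  rw [Fin.sum_univ_two]
  have h (i : Fin 2) : c.slope x i ^ 2 ≤ (c.lip : ℝ) ^ 2 := sq_le_sq' (by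
    have := neg_le_of_abs_le (c.abs_slope_le hx i)
    linarith) (le_of_abs_le (c.abs_slope_le hx i))
  linarith [h 0, h 1]

lemma volume_U_lt_top : volume c.U < ⊤ :=
  (measure_mono c.U_subset).trans_lt measure_ball_lt_top

lemma measure_univ_lt_top : c.measure univ < ⊤ := by
  rw [c.measure_apply MeasurableSet.univ, preimage_univ, univ_inter]
  calc _ ≤ ∫⁻ _ in c.U, ENNReal.ofReal (Real.sqrt (1 + 2 * (c.lip : ℝ) ^ 2)) := by
        refine lintegral_mono_ae ?_
        filter_upwards [c.ae_differentiableAt, ae_restrict_mem c.isOpen_U.measurableSet]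
          with x hx hU
        exact ENNReal.ofReal_le_ofReal (c.areaElement_le hU hx)
    _ < ⊤ := by
        rw [setLIntegral_const]
        exact ENNReal.mul_lt_top ENNReal.ofReal_lt_top c.volume_U_lt_top

end Chart

end

section

variable {Ω : Set Space}

/-! ### The surface measure in charts -/

lemma exists_finite_cover (hΩ : IsStrongLipschitzDomain Ω) (hc : IsCompact (frontier Ω)) :
    ∃ (N : ℕ) (C : Fin N → Chart Ω), frontier Ω ⊆ ⋃ k, (C k).dom := by
  have h1 : ∀ p : frontier Ω, ∃ c : Chart Ω, (p : Space) ∈ c.dom := by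
    intro p
    obtain ⟨ε, h, w, v, a, hp⟩ := hΩ.2 p p.2
    refine ⟨⟨p, ε, h, w, v, a, hp, Metric.ball 0 ε, Metric.isOpen_ball,
      ⟨0, Metric.mem_ball_self hp.eps_pos⟩, subset_rfl⟩, ?_⟩
    have h0 : (WithLp.toLp 2 fun i => inner ℝ (w i) ((p : Space) - p) : Plane) = 0 := by
      ext i
      simp
    refine ⟨?_, ?_⟩
    · change (WithLp.toLp 2 fun i => inner ℝ (w i) ((p : Space) - p) : Plane) ∈ _
      rw [h0]
      exact Metric.mem_ball_self hp.eps_pos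
    · simp [Chart.height, hp.height_pos]
  choose c hcm using h1
  obtain ⟨t, ht⟩ := hc.elim_finite_subcover (fun p => (c p).dom) (fun p => (c p).isOpen_dom)
    (fun y hy => mem_iUnion.mpr ⟨⟨y, hy⟩, hcm ⟨y, hy⟩⟩)
  refine ⟨t.card, fun k => c (t.equivFin.symm k), fun y hy => ?_⟩
  obtain ⟨p, hp, hyp⟩ := mem_iUnion₂.mp (ht hy)
  exact mem_iUnion.mpr ⟨t.equivFin ⟨p, hp⟩, by simpa using hyp⟩

section Cover

variable {N : ℕ} (C : Fin N → Chart Ω)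

/-- Disjoint pieces of the chart domains of a finite family of charts. -/
def piece (k : Fin N) : Set Space := disjointed (fun k => (C k).surf) k

lemma measurableSet_piece (k : Fin N) : MeasurableSet (piece C k) := by
  rw [piece, disjointed_apply, Finset.sup_set_eq_biUnion]
  exact (C k).measurableSet_surf.diff
    (Finset.measurableSet_biUnion _ fun j _ => (C j).measurableSet_surf)

lemma piece_subset (k : Fin N) : piece C k ⊆ (C k).surf := disjointed_subset _ k

lemma pairwise_disjoint_piece : Pairwise (Function.onFun Disjoint (piece C)) :=
  disjoint_disjointed _

lemma iUnion_piece (hC : frontier Ω ⊆ ⋃ k, (C k).dom) : ⋃ k, piece C k = frontier Ω := by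
  unfold piece
  rw [iUnion_disjointed]
  refine subset_antisymm (iUnion_subset fun k => inter_subset_left) fun y hy => ?_
  obtain ⟨k, hk⟩ := mem_iUnion.mp (hC hy)
  exact mem_iUnion.mpr ⟨k, hy, hk⟩

lemma Chart.measure_inter_surf (c : Chart Ω) (A : Set Space) :
    c.measure (A ∩ c.surf) = c.measure A :=
  measure_inter_conull c.measure_compl_surf

/-- Compatibility on overlaps in the form needed for gluing: each piece may be measured in its own
chart. -/
lemma Chart.sum_measure_piece (c : Chart Ω) (hC : frontier Ω ⊆ ⋃ k, (C k).dom) {A : Set Space}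
    (hA : MeasurableSet A) (hAc : A ⊆ c.surf) :
    c.measure A = ∑ k, (C k).measure (A ∩ piece C k) := by
  have h1 : A = ⋃ k, A ∩ piece C k := by
    rw [← inter_iUnion, iUnion_piece C hC]
    exact (inter_eq_left.mpr (hAc.trans inter_subset_left)).symm
  conv_lhs => rw [h1]
  rw [measure_iUnion (fun i j hij => (pairwise_disjoint_piece C hij).mono inter_subset_right
    inter_subset_right) (fun k => hA.inter (measurableSet_piece C k)), tsum_fintype]
  refine Finset.sum_congr rfl fun k _ => ?_
  exact c.measure_eq_of_subset_inter (C k) (hA.inter (measurableSet_piece C k))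
    (inter_subset_inter hAc (piece_subset C k))

/-- The glued measure dominates every chart measure by `Chart.sum_measure_piece`. Conversely, any
measure above all chart measures dominates it on each of the disjoint pieces. -/
lemma surfaceMeasure_eq_sum (hC : frontier Ω ⊆ ⋃ k, (C k).dom) :
    surfaceMeasure Ω = ∑ k, (C k).measure.restrict (piece C k) := by
  have happ {A : Set Space} (hA : MeasurableSet A) :
      (∑ k, (C k).measure.restrict (piece C k)) A = ∑ k, (C k).measure (A ∩ piece C k) := by
    rw [Measure.finsetSum_apply]
    exact Finset.sum_congr rfl fun k _ => Measure.restrict_apply hA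
  refine le_antisymm (iSup_le fun c => Measure.le_iff.mpr fun A hA => ?_)
    (Measure.le_iff.mpr fun A hA => ?_)
  · rw [happ hA, ← c.measure_inter_surf A,
      c.sum_measure_piece C hC (hA.inter c.measurableSet_surf) inter_subset_right]
    exact Finset.sum_le_sum fun k _ =>
      measure_mono (inter_subset_inter_left _ inter_subset_left)
  · rw [happ hA]
    calc _ ≤ ∑ k, surfaceMeasure Ω (A ∩ piece C k) :=
          Finset.sum_le_sum fun k _ =>
            (le_iSup (fun c : Chart Ω => c.measure) (C k)) _
      _ = surfaceMeasure Ω (⋃ k, A ∩ piece C k) := by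
          rw [measure_iUnion (fun i j hij => (pairwise_disjoint_piece C hij).mono
            inter_subset_right inter_subset_right)
            (fun k => hA.inter (measurableSet_piece C k)), tsum_fintype]
      _ ≤ _ := measure_mono (iUnion_subset fun k => inter_subset_left)

/-- Turns surface integrals over a chart domain into weighted integrals over the parameter set;
every later transfer between the two rests on it. -/
lemma surfaceMeasure_restrict_surf (hC : frontier Ω ⊆ ⋃ k, (C k).dom) (c : Chart Ω) :
    (surfaceMeasure Ω).restrict c.surf = c.measure := by
  ext A hA
  rw [Measure.restrict_apply hA, ← c.measure_inter_surf A,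
    c.sum_measure_piece C hC (hA.inter c.measurableSet_surf) inter_subset_right,
    surfaceMeasure_eq_sum C hC, Measure.finsetSum_apply]
  exact Finset.sum_congr rfl fun k _ => Measure.restrict_apply (hA.inter c.measurableSet_surf)

lemma surfaceMeasure_univ_lt_top (hC : frontier Ω ⊆ ⋃ k, (C k).dom) :
    surfaceMeasure Ω univ < ⊤ := by
  rw [surfaceMeasure_eq_sum C hC, Measure.finsetSum_apply]
  refine ENNReal.sum_lt_top.mpr fun k _ => ?_
  exact (Measure.restrict_apply_le _ _).trans_lt (C k).measure_univ_lt_top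

lemma ae_mem_frontier (hC : frontier Ω ⊆ ⋃ k, (C k).dom) :
    ∀ᵐ y ∂surfaceMeasure Ω, y ∈ frontier Ω := by
  rw [surfaceMeasure_eq_sum C hC, ae_iff, Measure.finsetSum_apply]
  refine Finset.sum_eq_zero fun k _ => ?_
  rw [Measure.restrict_apply' (measurableSet_piece C k)]
  have : {y | y ∉ frontier Ω} ∩ piece C k = ∅ :=
    eq_empty_of_forall_notMem fun y hy => hy.1 (piece_subset C k hy.2).1
  rw [this, measure_empty]

lemma ae_of_ae_surf (hC : frontier Ω ⊆ ⋃ k, (C k).dom) {P : Space → Prop}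
    (h : ∀ k, ∀ᵐ y ∂surfaceMeasure Ω, y ∈ (C k).surf → P y) : ∀ᵐ y ∂surfaceMeasure Ω, P y := by
  filter_upwards [ae_mem_frontier C hC, ae_all_iff.mpr h] with y hy hP
  obtain ⟨k, hk⟩ := mem_iUnion.mp (hC hy)
  exact hP k ⟨hy, hk⟩

end Cover

/-- The boundary is covered by finitely many charts. -/
def IsFinitelyCovered (Ω : Set Space) : Prop :=
  ∃ (N : ℕ) (C : Fin N → Chart Ω), frontier Ω ⊆ ⋃ k, (C k).dom

namespace Chart

variable (c : Chart Ω)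

/-- The surface measure in the coordinates of a chart. -/
def planeMeasure : Measure Plane :=
  (volume.restrict c.U).withDensity fun x => ENNReal.ofReal (c.areaElement x)

lemma planeMeasure_ac : c.planeMeasure ≪ volume.restrict c.U :=
  withDensity_absolutelyContinuous _ _

/-- The area element is positive wherever the graph function is differentiable, so null sets in the
plane and on the surface correspond in both directions. -/
lemma ac_planeMeasure : volume.restrict c.U ≪ c.planeMeasure := by
  refine withDensity_absolutelyContinuous' c.measurable_areaElement.ennreal_ofReal.aemeasurable ?_
  filter_upwards [c.ae_differentiableAt] with x hx
  exact (ENNReal.ofReal_pos.mpr (c.areaElement_pos hx)).ne'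

lemma aemeasurable_inv : AEMeasurable c.inv c.planeMeasure :=
  ⟨c.invExt, c.continuous_invExt.measurable, c.inv_ae_eq_invExt⟩

lemma map_inv : Measure.map c.inv c.planeMeasure = c.measure := rfl

lemma map_coords : Measure.map c.coords c.measure = c.planeMeasure := by
  rw [← map_inv, AEMeasurable.map_map_of_aemeasurable c.continuous_coords.aemeasurable
    c.aemeasurable_inv]
  have : c.coords ∘ c.inv = id := funext fun x => c.coords_inv x
  rw [this, Measure.map_id]

variable {c}

lemma ae_coords (hΩ : IsFinitelyCovered Ω) {P : Plane → Prop}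
    (h : ∀ᵐ x ∂volume.restrict c.U, P x) :
    ∀ᵐ y ∂surfaceMeasure Ω, y ∈ c.surf → P (c.coords y) := by
  obtain ⟨N, C, hC⟩ := hΩ
  rw [← ae_restrict_iff' c.measurableSet_surf, surfaceMeasure_restrict_surf C hC c]
  refine ae_of_ae_map c.continuous_coords.aemeasurable ?_
  rw [map_coords]
  exact c.planeMeasure_ac.ae_le h

lemma ae_inv (hΩ : IsFinitelyCovered Ω) {P : Space → Prop}
    (h : ∀ᵐ y ∂surfaceMeasure Ω, y ∈ c.surf → P y) :
    ∀ᵐ x ∂volume.restrict c.U, P (c.inv x) := by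
  obtain ⟨N, C, hC⟩ := hΩ
  rw [← ae_restrict_iff' c.measurableSet_surf, surfaceMeasure_restrict_surf C hC c,
    ← map_inv] at h
  exact c.ac_planeMeasure.ae_le (ae_of_ae_map c.aemeasurable_inv h)

/-- A property that holds almost everywhere in the parameters holds almost everywhere in the
chart domain. -/
lemma ae_surf (hΩ : IsFinitelyCovered Ω) {P : Space → Prop}
    (h : ∀ᵐ x ∂volume.restrict c.U, P (c.inv x)) :
    ∀ᵐ y ∂surfaceMeasure Ω, y ∈ c.surf → P y := by
  filter_upwards [ae_coords hΩ h] with y hy hs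
  rw [← c.inv_coords hs]
  exact hy hs

lemma setIntegral_surf (hΩ : IsFinitelyCovered Ω) {E : Type*} [NormedAddCommGroup E]
    [NormedSpace ℝ E] {F : Space → E} (hF : AEStronglyMeasurable F (surfaceMeasure Ω)) :
    ∫ y in c.surf, F y ∂surfaceMeasure Ω = ∫ x in c.U, c.areaElement x • F (c.inv x) := by
  obtain ⟨N, C, hC⟩ := hΩ
  have h1 := hF.restrict (s := c.surf)
  rw [surfaceMeasure_restrict_surf C hC c, ← map_inv] at h1 ⊢
  rw [integral_map c.aemeasurable_inv h1, planeMeasure,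
    integral_withDensity_eq_integral_toReal_smul c.measurable_areaElement.ennreal_ofReal
      (Eventually.of_forall fun x => ENNReal.ofReal_lt_top)]
  refine integral_congr_ae (Eventually.of_forall fun x => ?_)
  change (ENNReal.ofReal (c.areaElement x)).toReal • F (c.inv x) = _
  rw [ENNReal.toReal_ofReal (show 0 ≤ c.areaElement x from Real.sqrt_nonneg _)]

end Chart

lemma IsFinitelyCovered.isFiniteMeasure (hΩ : IsFinitelyCovered Ω) :
    IsFiniteMeasure (surfaceMeasure Ω) := by
  obtain ⟨N, C, hC⟩ := hΩ
  exact ⟨surfaceMeasure_univ_lt_top C hC⟩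

lemma IsFinitelyCovered.ae_of_ae_chart (hΩ : IsFinitelyCovered Ω) {P : Space → Prop}
    (h : ∀ c : Chart Ω, ∀ᵐ x ∂volume.restrict c.U, P (c.inv x)) :
    ∀ᵐ y ∂surfaceMeasure Ω, P y := by
  obtain ⟨N, C, hC⟩ := id hΩ
  exact ae_of_ae_surf C hC fun k => Chart.ae_surf hΩ (h (C k))

end

section

/-! ### Algebra of the tangential frame -/

/-- The vector product of real vectors. -/
def crossR (a b : Space) : Space := WithLp.toLp 2 (crossProduct a.ofLp b.ofLp)

/-- Here σ is the triple product v · (w₀ × w₁), with σ² = 1. The frame w₀, w₁, v may be negatively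
oriented, so the sign has to be carried along; it appears on both sides of the integration by parts.
-/
lemma IsLipschitzPatch.exists_orientation {Ω : Set Space} {p : Space} {ε h : ℝ}
    {w : Fin 2 → Space} {v : Space} {a : Plane → ℝ} (hp : IsLipschitzPatch Ω p ε h w v a) :
    ∃ σ : ℝ, ∀ s : Fin 2 → ℝ, v - ∑ i, s i • w i =
      σ • crossR (w 0 + s 0 • v) (w 1 + s 1 • v) := by
  set σ : ℝ := inner ℝ v (crossR (w 0) (w 1)) with hσ
  have hin (a b : Space) : inner ℝ a b = a 0 * b 0 + a 1 * b 1 + a 2 * b 2 := by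
    simp [PiLp.inner_apply, Fin.sum_univ_three, mul_comm]
  have hcr (a b : Space) : crossR a b 0 = a 1 * b 2 - a 2 * b 1 ∧
      crossR a b 1 = a 2 * b 0 - a 0 * b 2 ∧ crossR a b 2 = a 0 * b 1 - a 1 * b 0 := by
    simp [crossR, cross_apply]
  have rot1 (a b d : Space) : inner ℝ a (crossR b d) = -inner ℝ d (crossR b a) := by
    simp only [hin, hcr]; ring
  have rot2 (a b d : Space) : inner ℝ a (crossR b d) = -inner ℝ b (crossR a d) := by
    simp only [hin, hcr]; ring
  have self1 (a b : Space) : inner ℝ a (crossR a b) = 0 := by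
    simp only [hin, hcr]; ring
  have self2 (a b : Space) : inner ℝ a (crossR b a) = 0 := by
    simp only [hin, hcr]; ring
  have c01 : crossR (w 0) (w 1) = σ • v := by
    have := hp.expansion (crossR (w 0) (w 1))
    rw [Fin.sum_univ_two, self1, self2, ← hσ] at this
    simpa using this
  have c0v : crossR (w 0) v = (-σ) • w 1 := by
    have := hp.expansion (crossR (w 0) v)
    rw [Fin.sum_univ_two, self1, self2, rot1 (w 1), ← hσ] at this
    simpa using this
  have cv1 : crossR v (w 1) = (-σ) • w 0 := by
    have := hp.expansion (crossR v (w 1))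
    rw [Fin.sum_univ_two, self1, self2, rot2 (w 0), ← hσ] at this
    simpa using this
  have hsq : σ * σ = 1 := by
    have h1 : inner ℝ (crossR (w 0) (w 1)) (crossR (w 0) (w 1)) = inner ℝ (w 0) (w 0) *
        inner ℝ (w 1) (w 1) - inner ℝ (w 0) (w 1) * (inner ℝ (w 0) (w 1) : ℝ) := by
      simp only [hin, hcr]; ring
    rw [c01, inner_smul_left, inner_smul_right, hp.inner_axis, hp.inner_base, hp.inner_base,
      hp.inner_base] at h1
    simpa using h1
  refine ⟨σ, fun s => ?_⟩
  have hexp : crossR (w 0 + s 0 • v) (w 1 + s 1 • v) =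
      crossR (w 0) (w 1) + s 1 • crossR (w 0) v + s 0 • crossR v (w 1) := by
    ext i
    fin_cases i <;> simp [hcr] <;> ring
  rw [hexp, c01, c0v, cv1, smul_add, smul_add, smul_smul, hsq, Fin.sum_univ_two]
  simp only [smul_smul]
  have e (t : ℝ) : σ * (t * -σ) = -t := by linear_combination (-t) * hsq
  rw [e, e, one_smul, neg_smul, neg_smul]
  abel

section Scalars

variable {𝕜 : Type*} [RCLike 𝕜]

variable (𝕜) in
/-- A real vector with its entries regarded as scalars. -/
def toK (n : Space) : EuclideanSpace 𝕜 (Fin 3) := WithLp.toLp 2 fun i => ((n i : ℝ) : 𝕜)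

lemma toK_apply (n : Space) (i : Fin 3) : toK 𝕜 n i = ((n i : ℝ) : 𝕜) := rfl

lemma unitNormalK_eq (Ω : Set Space) (ζ : Space) : unitNormalK 𝕜 Ω ζ = toK 𝕜 (unitNormal Ω ζ) :=
  rfl

lemma dot_eq (u v : EuclideanSpace 𝕜 (Fin 3)) : dot u v = u 0 * v 0 + u 1 * v 1 + u 2 * v 2 := by
  rw [dot, Fin.sum_univ_three]

lemma cross_zero (u v : EuclideanSpace 𝕜 (Fin 3)) : cross u v 0 = u 1 * v 2 - u 2 * v 1 := by
  simp [cross, cross_apply]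

lemma cross_one (u v : EuclideanSpace 𝕜 (Fin 3)) : cross u v 1 = u 2 * v 0 - u 0 * v 2 := by
  simp [cross, cross_apply]

lemma cross_two (u v : EuclideanSpace 𝕜 (Fin 3)) : cross u v 2 = u 0 * v 1 - u 1 * v 0 := by
  simp [cross, cross_apply]

lemma inner_eq (u v : EuclideanSpace 𝕜 (Fin 3)) : inner 𝕜 u v =
    starRingEnd 𝕜 (u 0) * v 0 + starRingEnd 𝕜 (u 1) * v 1 + starRingEnd 𝕜 (u 2) * v 2 := by
  simp [PiLp.inner_apply, Fin.sum_univ_three, mul_comm]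

lemma rot_zero (Φ : Space → EuclideanSpace 𝕜 (Fin 3)) (y : Space) :
    rot Φ y 0 = partialDeriv Φ 1 2 y - partialDeriv Φ 2 1 y := rfl

lemma rot_one (Φ : Space → EuclideanSpace 𝕜 (Fin 3)) (y : Space) :
    rot Φ y 1 = partialDeriv Φ 2 0 y - partialDeriv Φ 0 2 y := rfl

lemma rot_two (Φ : Space → EuclideanSpace 𝕜 (Fin 3)) (y : Space) :
    rot Φ y 2 = partialDeriv Φ 0 1 y - partialDeriv Φ 1 0 y := rfl

lemma fderiv_apply_eq (Φ : Space → EuclideanSpace 𝕜 (Fin 3)) (y t : Space) (i : Fin 3) :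
    fderiv ℝ Φ y t i = (t 0 : 𝕜) * partialDeriv Φ 0 i y + (t 1 : 𝕜) * partialDeriv Φ 1 i y +
      (t 2 : 𝕜) * partialDeriv Φ 2 i y := by
  have ht : t = ∑ j, t j • EuclideanSpace.single j (1 : ℝ) := by
    ext k
    fin_cases k <;> simp [Fin.sum_univ_three]
  conv_lhs => rw [ht, map_sum]
  simp [Fin.sum_univ_three, partialDeriv, RCLike.real_smul_eq_coe_mul]

/-- The double product rule (t₀ × t₁) × Z = (t₀ · Z) t₁ − (t₁ · Z) t₀, paired with Q. Only the
tangential components of Q enter. -/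
lemma inner_cross_crossR (σ : ℝ) (t₀ t₁ : Space) (Q Z : EuclideanSpace 𝕜 (Fin 3)) :
    inner 𝕜 Q (cross (toK 𝕜 (σ • crossR t₀ t₁)) Z) =
      (σ : 𝕜) * (dot (toK 𝕜 t₀) Z * starRingEnd 𝕜 (dot (toK 𝕜 t₁) Q) -
        dot (toK 𝕜 t₁) Z * starRingEnd 𝕜 (dot (toK 𝕜 t₀) Q)) := by
  simp only [inner_eq, cross_zero, cross_one, cross_two, dot_eq, toK_apply, map_add, map_mul,
    RCLike.conj_ofReal]
  simp [crossR, cross_apply]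
  ring

/-- The rotation encodes the antisymmetric part of DΦ, evaluated here on the pair t₀, t₁. Only
derivatives in tangential directions remain, which can be computed in the chart. -/
lemma dot_crossR_rot (σ : ℝ) (t₀ t₁ : Space) (Φ : Space → EuclideanSpace 𝕜 (Fin 3)) (y : Space) :
    dot (toK 𝕜 (σ • crossR t₀ t₁)) (rot Φ y) =
      (σ : 𝕜) * (dot (toK 𝕜 t₁) (fderiv ℝ Φ y t₀) - dot (toK 𝕜 t₀) (fderiv ℝ Φ y t₁)) := by
  simp only [dot_eq, fderiv_apply_eq, rot_zero, rot_one, rot_two, toK_apply]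
  simp [crossR, cross_apply]
  ring

lemma dot_toK_add_smul (a b : Space) (s : ℝ) (Z : EuclideanSpace 𝕜 (Fin 3)) :
    dot (toK 𝕜 (a + s • b)) Z = dot (toK 𝕜 a) Z + (s : 𝕜) * dot (toK 𝕜 b) Z := by
  simp [dot_eq, toK_apply]
  ring

lemma dot_toK_smul (s : ℝ) (b : Space) (Z : EuclideanSpace 𝕜 (Fin 3)) :
    dot (toK 𝕜 (s • b)) Z = (s : 𝕜) * dot (toK 𝕜 b) Z := by
  simp [dot_eq, toK_apply]
  ring

lemma inner_cross_toK_smul (s : ℝ) (b : Space) (Q Z : EuclideanSpace 𝕜 (Fin 3)) :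
    inner 𝕜 Q (cross (toK 𝕜 (s • b)) Z) = (s : 𝕜) * inner 𝕜 Q (cross (toK 𝕜 b) Z) := by
  simp [inner_eq, cross_zero, cross_one, cross_two, toK_apply]
  ring

/-- The product with a real vector as a continuous linear map. -/
def dotCLM (b : Space) : EuclideanSpace 𝕜 (Fin 3) →L[ℝ] 𝕜 :=
  ∑ i, b i • (EuclideanSpace.proj i : EuclideanSpace 𝕜 (Fin 3) →L[𝕜] 𝕜).restrictScalars ℝ

lemma dotCLM_apply (b : Space) (Z : EuclideanSpace 𝕜 (Fin 3)) : dotCLM b Z = dot (toK 𝕜 b) Z := by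
  simp [dotCLM, dot_eq, Fin.sum_univ_three, toK_apply, RCLike.real_smul_eq_coe_mul]

namespace Chart

variable {Ω : Set Space} (c : Chart Ω)

lemma pinv_mul_jacobian {x : Plane} (hd : DifferentiableAt ℝ c.a x) :
    pinv (c.jacobian x) * c.jacobian x = 1 := by
  rw [pinv, Matrix.mul_assoc]
  refine Matrix.nonsing_inv_mul _ (Ne.isUnit ?_)
  rw [c.det_gram hd]
  exact (lt_of_lt_of_le one_pos (c.one_le_sq_sum x)).ne'

lemma liftGradient_apply (x : Plane) (g : EuclideanSpace 𝕜 (Fin 2)) (i : Fin 3) :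
    c.liftGradient x g i = ∑ k, ((pinv (c.jacobian x) k i : ℝ) : 𝕜) * g k := by
  simp [liftGradient, Matrix.mulVec, dotProduct]

lemma dot_toK_liftGradient (b : Space) (x : Plane) (g : EuclideanSpace 𝕜 (Fin 2)) :
    dot (toK 𝕜 b) (c.liftGradient x g) =
      ∑ k, (((pinv (c.jacobian x)).mulVec b.ofLp k : ℝ) : 𝕜) * g k := by
  simp only [dot_eq, liftGradient_apply, Fin.sum_univ_two, Matrix.mulVec, dotProduct,
    Fin.sum_univ_three, toK_apply]
  push_cast
  ring

/-- The tangent vectors are the columns of the Jacobian, and the pseudoinverse is a left inverse of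
it. -/
lemma dot_tangent_liftGradient {x : Plane} (hd : DifferentiableAt ℝ c.a x)
    (g : EuclideanSpace 𝕜 (Fin 2)) (j : Fin 2) :
    dot (toK 𝕜 (c.tangent x j)) (c.liftGradient x g) = g j := by
  have h1 : (pinv (c.jacobian x)).mulVec (c.tangent x j).ofLp = fun k => (1 : Matrix _ _ ℝ) k j := by
    ext k
    rw [← c.pinv_mul_jacobian hd, Matrix.mul_apply]
    simp only [Matrix.mulVec, dotProduct, c.jacobian_apply hd]
  rw [dot_toK_liftGradient, h1]
  simp [Matrix.one_apply]

/-- The pseudoinverse ends in Jᵀ, which annihilates vectors orthogonal to the tangent plane. -/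
lemma dot_conormal_liftGradient {x : Plane} (hd : DifferentiableAt ℝ c.a x)
    (g : EuclideanSpace 𝕜 (Fin 2)) :
    dot (toK 𝕜 (c.conormal x)) (c.liftGradient x g) = 0 := by
  have h1 : (pinv (c.jacobian x)).mulVec (c.conormal x).ofLp = 0 := by
    have h2 : (c.jacobian x).transpose.mulVec (c.conormal x).ofLp = 0 := by
      ext j
      have := c.inner_conormal_tangent x j
      simp only [PiLp.inner_apply] at this
      simp only [Matrix.mulVec, dotProduct, Matrix.transpose_apply, c.jacobian_apply hd]
      simpa using this
    rw [pinv, ← Matrix.mulVec_mulVec, h2, Matrix.mulVec_zero]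
  rw [dot_toK_liftGradient, h1]
  simp

lemma dot_normal_liftGradient {x : Plane} (hd : DifferentiableAt ℝ c.a x)
    (g : EuclideanSpace 𝕜 (Fin 2)) :
    dot (toK 𝕜 (c.normal x)) (c.liftGradient x g) = 0 := by
  rw [normal_eq_smul, dot_toK_smul, c.dot_conormal_liftGradient hd, mul_zero]

/-- The entries of the adjugate of the Gram matrix are bounded by its determinant 1 + |∇a|², so its
inverse has entries of modulus at most 1. Those of the Jacobian are at most 1 + `c.lip`, and each
product entry has two summands. -/
lemma abs_pinv_le {x : Plane} (hx : x ∈ c.U) (hd : DifferentiableAt ℝ c.a x) (k : Fin 2)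
    (i : Fin 3) : |pinv (c.jacobian x) k i| ≤ 2 * (1 + c.lip) := by
  have hg (i j : Fin 2) : |((c.jacobian x).transpose * c.jacobian x)⁻¹ i j| ≤ 1 := by
    have hdet := c.det_gram hd
    have h1 := lt_of_lt_of_le one_pos (c.one_le_sq_sum x)
    rw [Matrix.inv_def, Matrix.adjugate_fin_two, hdet, Matrix.smul_apply, smul_eq_mul,
      Ring.inverse_eq_inv', abs_mul, abs_inv, abs_of_pos h1, inv_mul_le_iff₀ h1, mul_one]
    rw [Fin.sum_univ_two]
    fin_cases i <;> fin_cases j <;> (rw [abs_le]; constructor) <;> simp [c.gram_apply hd] <;>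
      nlinarith [sq_nonneg (c.slope x 0 + c.slope x 1), sq_nonneg (c.slope x 0 - c.slope x 1),
        sq_nonneg (c.slope x 0), sq_nonneg (c.slope x 1)]
  have hJ (j : Fin 2) : |c.jacobian x i j| ≤ 1 + c.lip := by
    rw [c.jacobian_apply hd, ← Real.norm_eq_abs]
    refine (PiLp.norm_apply_le _ _).trans ?_
    refine (norm_add_le _ _).trans ?_
    rw [norm_smul, c.isPatch.norm_normal, c.isPatch.orthonormal.1, mul_one]
    simpa using c.abs_slope_le hx j
  rw [pinv, Matrix.mul_apply, Fin.sum_univ_two, Matrix.transpose_apply, Matrix.transpose_apply]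
  refine (abs_add_le _ _).trans ?_
  rw [abs_mul, abs_mul]
  have h (j : Fin 2) := mul_le_mul (hg k j) (hJ j) (abs_nonneg _) zero_le_one
  linarith [h 0, h 1]

lemma measurable_pinv (k : Fin 2) (i : Fin 3) :
    Measurable fun x => pinv (c.jacobian x) k i := by
  have h (i j : Fin 2) : Measurable fun x => ((c.jacobian x).transpose * c.jacobian x) i j := by
    simp only [Matrix.mul_apply, Matrix.transpose_apply]
    exact Finset.measurable_sum _ fun k _ =>
      (c.measurable_jacobian k i).mul (c.measurable_jacobian k j)
  have hdet : Measurable fun x => (((c.jacobian x).transpose * c.jacobian x).det)⁻¹ := by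
    simp only [Matrix.det_fin_two]
    exact (((h 0 0).mul (h 1 1)).sub ((h 0 1).mul (h 1 0))).inv
  have hinv (i j : Fin 2) :
      Measurable fun x => ((c.jacobian x).transpose * c.jacobian x)⁻¹ i j := by
    simp only [Matrix.inv_def, Matrix.adjugate_fin_two, Matrix.smul_apply, smul_eq_mul,
      Ring.inverse_eq_inv']
    refine hdet.mul ?_
    fin_cases i <;> fin_cases j <;> simp
    · exact h 1 1
    · exact h 0 1
    · exact h 1 0
    · exact h 0 0
  have he : (fun x => pinv (c.jacobian x) k i) = fun x =>
      ∑ j, ((c.jacobian x).transpose * c.jacobian x)⁻¹ k j * c.jacobian x i j :=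
    funext fun x => Matrix.mul_apply
  rw [he]
  exact Finset.measurable_sum _ fun j _ => (hinv k j).mul (c.measurable_jacobian i j)

lemma memLp_liftGradient {G : Plane → EuclideanSpace 𝕜 (Fin 2)}
    (hG : MemLp G 2 (volume.restrict c.U)) :
    MemLp (fun x => c.liftGradient x (G x)) 2 (volume.restrict c.U) := by
  refine MemLp.of_eval_piLp fun i => ?_
  simp only [liftGradient_apply]
  refine memLp_finsetSum _ fun k _ => ?_
  have h1 := hG.eval_piLp k
  refine h1.of_le_mul (c := 2 * (1 + c.lip)) ?_ ?_
  · exact (RCLike.measurable_ofReal.comp (c.measurable_pinv k i)).aestronglyMeasurable.mul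
      h1.aestronglyMeasurable
  · filter_upwards [c.ae_differentiableAt, ae_restrict_mem c.isOpen_U.measurableSet] with x hd hx
    rw [norm_mul, RCLike.norm_ofReal]
    exact mul_le_mul_of_nonneg_right (c.abs_pinv_le hx hd k i) (norm_nonneg _)

end Chart

end Scalars

end

/-! ### Integration by parts in a single chart -/

section

variable {𝕜 : Type*} [RCLike 𝕜] {Ω : Set Space}

lemma exists_smooth_cutoff {K U : Set Plane} (hK : IsCompact K) (hU : IsOpen U) (hKU : K ⊆ U) :
    ∃ η : Plane → ℝ, ContDiff ℝ ∞ η ∧ HasCompactSupport η ∧ tsupport η ⊆ U ∧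
      ∀ x ∈ K, η x = 1 := by
  obtain ⟨V, hVo, hKV, hVU, hVc⟩ := exists_open_between_and_isCompact_closure hK hU hKU
  obtain ⟨η, h0, h1, -⟩ := exists_contMDiffMap_zero_one_of_isClosed 𝓘(ℝ, Plane) (n := ⊤)
    hVo.isClosed_compl hK.isClosed
    (disjoint_left.mpr fun x hx hxK => hx (hKV hxK))
  have hs : tsupport η ⊆ closure V := closure_mono fun x hx => by
    by_contra hxV
    exact hx (h0 hxV)
  exact ⟨η, η.contMDiff.contDiff, HasCompactSupport.of_support_subset_isCompact hVc
    ((subset_tsupport _).trans hs), hs.trans hVU, fun x hx => h1 hx⟩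

namespace Chart

variable (c : Chart Ω)

/-- The components of a test field in a chart are Lipschitz test functions in the plane. -/
lemma exists_test_function {Φ : Space → EuclideanSpace 𝕜 (Fin 3)} (hΦ : ContDiff ℝ ∞ Φ)
    (hc : HasCompactSupport Φ) (hs : tsupport Φ ⊆ c.dom) (b : Space) :
    ∃ (K : NNReal) (φ : Plane → 𝕜), LipschitzWith K φ ∧ HasCompactSupport φ ∧ tsupport φ ⊆ c.U ∧
      ∀ x ∈ c.U, φ x = dot (toK 𝕜 b) (Φ (c.inv x)) ∧ (DifferentiableAt ℝ c.a x → ∀ j,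
        partialPlane j φ x = dot (toK 𝕜 b) (fderiv ℝ Φ (c.inv x) (c.tangent x j))) := by
  have hKc : IsCompact (c.coords '' (tsupport Φ ∩ frontier Ω)) :=
    (IsCompact.inter_right hc isClosed_frontier).image c.continuous_coords
  have hKU : c.coords '' (tsupport Φ ∩ frontier Ω) ⊆ c.U := by
    rintro _ ⟨y, hy, rfl⟩
    exact (hs hy.1).1
  -- The cutoff equals one on the parameters of boundary points in the support of Φ. It therefore
  -- changes no value over `c.U`, while supplying the compact support inside `c.U`.
  obtain ⟨η, hη, hηc, hηU, hη1⟩ := exists_smooth_cutoff hKc c.isOpen_U hKU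
  have hΨ : ContDiff ℝ ∞ fun y => η (c.coords y) • dotCLM b (Φ y) :=
    (hη.comp c.contDiff_coords).smul ((dotCLM (𝕜 := 𝕜) b).contDiff.comp hΦ)
  have hΨc : HasCompactSupport fun y => η (c.coords y) • dotCLM b (Φ y) := by
    refine HasCompactSupport.of_support_subset_isCompact hc fun y hy => subset_tsupport _ ?_
    intro h0
    simp [h0] at hy
  obtain ⟨K, hK⟩ : ∃ K, LipschitzWith K fun y => η (c.coords y) • dotCLM b (Φ y) :=
    ContDiff.lipschitzWith_of_hasCompactSupport hΨc hΨ (by simp)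
  have hcoords (x : Plane) : c.coords (c.invExt x) = x := c.coords_planePoint _ _
  have hsupp : tsupport (fun x => η (c.coords (c.invExt x)) • dotCLM b (Φ (c.invExt x))) ⊆
      tsupport η := closure_mono fun x hx => by
    intro h0
    simp [hcoords, h0] at hx
  have hval : ∀ x ∈ c.U, η (c.coords (c.invExt x)) • dotCLM b (Φ (c.invExt x)) =
      dotCLM b (Φ (c.inv x)) := by
    intro x hx
    rw [hcoords, c.invExt_eq hx]
    by_cases h0 : Φ (c.inv x) = 0
    · simp [h0]
    · have : η x = 1 := hη1 x ⟨c.inv x, ⟨subset_tsupport _ h0, (c.inv_mem_surf hx).1⟩,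
        c.coords_inv x⟩
      rw [this, one_smul]
  refine ⟨_, fun x => η (c.coords (c.invExt x)) • dotCLM b (Φ (c.invExt x)),
    hK.comp c.lipschitzWith_invExt,
    IsCompact.of_isClosed_subset hηc (isClosed_tsupport _) hsupp, hsupp.trans hηU,
    fun x hx => ⟨by rw [← dotCLM_apply, ← hval x hx], fun hd j => ?_⟩⟩
  have hev : (fun x => η (c.coords (c.invExt x)) • dotCLM b (Φ (c.invExt x))) =ᶠ[𝓝 x]
      fun x => dotCLM b (Φ (c.inv x)) := by
    filter_upwards [c.isOpen_U.mem_nhds hx] with z hz using hval z hz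
  have hdΦ : HasFDerivAt Φ (fderiv ℝ Φ (c.inv x)) (c.inv x) :=
    ((hΦ.differentiable (by simp)) _).hasFDerivAt
  have hcomp := (dotCLM (𝕜 := 𝕜) b).hasFDerivAt.comp x
    (hdΦ.comp x (c.hasFDerivAt_inv hd).differentiableAt.hasFDerivAt)
  rw [partialPlane, hev.fderiv_eq]
  have := hcomp.fderiv
  rw [show (fun x => dotCLM b (Φ (c.inv x))) = ⇑(dotCLM (𝕜 := 𝕜) b) ∘ Φ ∘ c.inv from rfl, this]
  simp only [ContinuousLinearMap.comp_apply]
  rw [c.fderiv_inv_single hd, dotCLM_apply]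

/-- Integration by parts in a chart. -/
lemma integral_chart {u : Plane → 𝕜} {G : Plane → EuclideanSpace 𝕜 (Fin 2)}
    (h : HasSobolevGradient c.U u G) {Φ : Space → EuclideanSpace 𝕜 (Fin 3)} (hΦ : ContDiff ℝ ∞ Φ)
    (hc : HasCompactSupport Φ) (hs : tsupport Φ ⊆ c.dom) :
    ∫ x in c.U, c.areaElement x •
        inner 𝕜 (c.liftGradient x (G x)) (cross (toK 𝕜 (c.normal x)) (Φ (c.inv x))) =
      ∫ x in c.U, c.areaElement x • inner 𝕜 (u x) (dot (toK 𝕜 (c.normal x)) (rot Φ (c.inv x))) := by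
  obtain ⟨σ, hσ⟩ := c.isPatch.exists_orientation
  obtain ⟨K0, φ0, l0, c0, s0, e0⟩ := c.exists_test_function hΦ hc hs (c.w 0)
  obtain ⟨K1, φ1, l1, c1, s1, e1⟩ := c.exists_test_function hΦ hc hs (c.w 1)
  obtain ⟨K2, φ2, l2, c2, s2, e2⟩ := c.exists_test_function hΦ hc hs c.v
  have hN (x : Plane) : c.conormal x = σ • crossR (c.tangent x 0) (c.tangent x 1) := hσ (c.slope x)
  -- The inner product is conjugate-linear in its first argument, where u and the lifted gradient
  -- stand.
  have h' := h.conj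
  have hfin := c.volume_U_lt_top.ne
  -- With φ0, φ1, φ2 the components of Φ along w₀, w₁, v, the slope-free terms need plain
  -- integration by parts; the terms in φ2 carry the slopes and form the wedge dφ2 ∧ da.
  have i1 := (h'.integral_partialPlane c.isOpen_U hfin l0 c0 s0).2
  have i2 := (h'.integral_partialPlane c.isOpen_U hfin l1 c1 s1).1
  have i3 := h'.integral_wedge c.isOpen_U hfin l2 c2 s2 c.lipschitzWith_ext
  have hu := h'.integrableOn hfin
  have hG (i : Fin 2) := h'.integrableOn_gradient hfin i
  simp only at i1 i2 i3 hG
  have hslope : ∀ x ∈ c.U, ∀ i, partialPlane i c.ext x = c.slope x i := by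
    intro x hx i
    rw [partialPlane, c.fderiv_ext hx, slope]
  have m (f : Plane → 𝕜) (i : Fin 2) := aestronglyMeasurable_partialPlane f i (volume.restrict c.U)
  have bnd {K : NNReal} {φ : Plane → 𝕜} (hφ : LipschitzWith K φ) (hφc : HasCompactSupport φ) :
      ∃ C, ∀ x, ‖φ x‖ ≤ C := hφ.continuous.bounded_above_of_compact_support hφc
  have intp {K : NNReal} {φ : Plane → 𝕜} (hφ : LipschitzWith K φ) (i : Fin 2) :
      IntegrableOn (fun x => partialPlane i φ x * starRingEnd 𝕜 (u x)) c.U :=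
    hu.bdd_mul (m φ i) (Eventually.of_forall fun x => norm_partialPlane_le hφ i x)
  have intφ {K : NNReal} {φ : Plane → 𝕜} (hφ : LipschitzWith K φ) (hφc : HasCompactSupport φ)
      (i : Fin 2) : IntegrableOn (fun x => φ x * starRingEnd 𝕜 (G x i)) c.U := by
    obtain ⟨C, hC⟩ := bnd hφ hφc
    exact (hG i).bdd_mul hφ.continuous.aestronglyMeasurable (Eventually.of_forall hC)
  have mext (i : Fin 2) : AEStronglyMeasurable (partialPlane i c.ext) (volume.restrict c.U) :=
    (measurable_partialPlane _ _).aestronglyMeasurable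
  have bext (i : Fin 2) (x : Plane) : ‖partialPlane i c.ext x‖ ≤ c.lip :=
    norm_partialPlane_le c.lipschitzWith_ext i x
  have int3 (i j : Fin 2) : IntegrableOn (fun x =>
      φ2 x * (partialPlane j c.ext x • starRingEnd 𝕜 (G x i))) c.U := by
    obtain ⟨C, hC⟩ := bnd l2 c2
    exact ((hG i).bdd_smul c.lip (mext j) (Eventually.of_forall (bext j))).bdd_mul
      l2.continuous.aestronglyMeasurable (Eventually.of_forall hC)
  have int4 : IntegrableOn (fun x => (partialPlane 1 c.ext x • partialPlane 0 φ2 x -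
        partialPlane 0 c.ext x • partialPlane 1 φ2 x) * starRingEnd 𝕜 (u x)) c.U := by
    refine hu.bdd_mul (c := c.lip * K2 + c.lip * K2) (((mext 1).smul (m φ2 0)).sub
      ((mext 0).smul (m φ2 1))) (Eventually.of_forall fun x => ?_)
    refine (norm_sub_le _ _).trans (add_le_add ?_ ?_) <;> rw [norm_smul] <;>
      exact mul_le_mul (bext _ x) (norm_partialPlane_le l2 _ x) (norm_nonneg _) c.lip.2
  calc _ = ∫ x in c.U, (σ : 𝕜) * ((φ0 x * starRingEnd 𝕜 (G x 1) - φ1 x * starRingEnd 𝕜 (G x 0)) +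
          (φ2 x * (partialPlane 0 c.ext x • starRingEnd 𝕜 (G x 1)) -
            φ2 x * (partialPlane 1 c.ext x • starRingEnd 𝕜 (G x 0)))) := by
        refine integral_congr_ae ?_
        filter_upwards [c.ae_differentiableAt, ae_restrict_mem c.isOpen_U.measurableSet]
          with x hd hx
        rw [RCLike.real_smul_eq_coe_mul, ← inner_cross_toK_smul, c.areaElement_smul_normal hd,
          hN, inner_cross_crossR, c.dot_tangent_liftGradient hd, c.dot_tangent_liftGradient hd,
          hslope x hx, hslope x hx, tangent, tangent, dot_toK_add_smul, dot_toK_add_smul,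
          (e0 x hx).1, (e1 x hx).1, (e2 x hx).1]
        simp only [RCLike.real_smul_eq_coe_mul]
        ring
    _ = (σ : 𝕜) * ((∫ x in c.U, φ0 x * starRingEnd 𝕜 (G x 1)) -
          (∫ x in c.U, φ1 x * starRingEnd 𝕜 (G x 0)) +
          ∫ x in c.U, (φ2 x * (partialPlane 0 c.ext x • starRingEnd 𝕜 (G x 1)) -
            φ2 x * (partialPlane 1 c.ext x • starRingEnd 𝕜 (G x 0)))) := by
        have j1 : IntegrableOn (fun x => φ0 x * starRingEnd 𝕜 (G x 1) -
            φ1 x * starRingEnd 𝕜 (G x 0)) c.U := (intφ l0 c0 1).sub (intφ l1 c1 0)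
        have j2 : IntegrableOn (fun x => φ2 x * (partialPlane 0 c.ext x • starRingEnd 𝕜 (G x 1)) -
            φ2 x * (partialPlane 1 c.ext x • starRingEnd 𝕜 (G x 0))) c.U :=
          (int3 1 0).sub (int3 0 1)
        rw [integral_const_mul, integral_add j1 j2, integral_sub (intφ l0 c0 1) (intφ l1 c1 0)]
    _ = (σ : 𝕜) * ((∫ x in c.U, partialPlane 0 φ1 x * starRingEnd 𝕜 (u x)) -
          (∫ x in c.U, partialPlane 1 φ0 x * starRingEnd 𝕜 (u x)) +
          ∫ x in c.U, (partialPlane 1 c.ext x • partialPlane 0 φ2 x -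
            partialPlane 0 c.ext x • partialPlane 1 φ2 x) * starRingEnd 𝕜 (u x)) := by
        rw [i1, i2, i3]
        ring
    _ = ∫ x in c.U, (σ : 𝕜) * ((partialPlane 0 φ1 x * starRingEnd 𝕜 (u x) -
          partialPlane 1 φ0 x * starRingEnd 𝕜 (u x)) +
          (partialPlane 1 c.ext x • partialPlane 0 φ2 x -
            partialPlane 0 c.ext x • partialPlane 1 φ2 x) * starRingEnd 𝕜 (u x)) := by
        have j1 : IntegrableOn (fun x => partialPlane 0 φ1 x * starRingEnd 𝕜 (u x) -
            partialPlane 1 φ0 x * starRingEnd 𝕜 (u x)) c.U := (intp l1 0).sub (intp l0 1)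
        rw [integral_const_mul, integral_add j1 int4,
          integral_sub (intp l1 0) (intp l0 1)]
    _ = _ := by
        refine integral_congr_ae ?_
        filter_upwards [c.ae_differentiableAt, ae_restrict_mem c.isOpen_U.measurableSet]
          with x hd hx
        have hR : c.areaElement x • inner 𝕜 (u x) (dot (toK 𝕜 (c.normal x)) (rot Φ (c.inv x))) =
            dot (toK 𝕜 (c.conormal x)) (rot Φ (c.inv x)) * starRingEnd 𝕜 (u x) := by
          rw [RCLike.inner_apply, RCLike.real_smul_eq_coe_mul, ← mul_assoc, ← dot_toK_smul,
            c.areaElement_smul_normal hd]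
        rw [hR, hN, dot_crossR_rot, (e0 x hx).2 hd, (e1 x hx).2 hd,
          (e2 x hx).2 hd, (e2 x hx).2 hd, hslope x hx, hslope x hx]
        conv_rhs =>
          rw [show toK 𝕜 (c.tangent x 1) = toK 𝕜 (c.w 1 + c.slope x 1 • c.v) from rfl,
            show toK 𝕜 (c.tangent x 0) = toK 𝕜 (c.w 0 + c.slope x 0 • c.v) from rfl,
            dot_toK_add_smul, dot_toK_add_smul]
        simp only [RCLike.real_smul_eq_coe_mul]
        ring

end Chart

end

section

variable {𝕜 : Type*} [RCLike 𝕜] {Ω : Set Space}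

/-! ### Measurability and integrability on the boundary -/

/-- On a chart domain F is (F ∘ k⁻¹) ∘ k, and k is the restriction of the continuous map `coords`;
finitely many chart domains carry the whole measure. -/
lemma IsFinitelyCovered.aestronglyMeasurable (hΩ : IsFinitelyCovered Ω) {E : Type*}
    [TopologicalSpace E] [TopologicalSpace.PseudoMetrizableSpace E] {F : Space → E}
    (hF : ∀ c : Chart Ω, AEStronglyMeasurable (fun x => F (c.inv x)) (volume.restrict c.U)) :
    AEStronglyMeasurable F (surfaceMeasure Ω) := by
  obtain ⟨N, C, hC⟩ := id hΩ
  have h1 (c : Chart Ω) : AEStronglyMeasurable F ((surfaceMeasure Ω).restrict c.surf) := by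
    rw [surfaceMeasure_restrict_surf C hC c]
    have h2 := (hF c).mono_ac c.planeMeasure_ac
    rw [← c.map_coords] at h2
    refine (h2.comp_aemeasurable c.continuous_coords.aemeasurable).congr ?_
    rw [← surfaceMeasure_restrict_surf C hC c]
    filter_upwards [ae_restrict_mem c.measurableSet_surf] with y hy
    simp only [Function.comp_apply]
    rw [c.inv_coords hy]
  have h3 : AEStronglyMeasurable F ((surfaceMeasure Ω).restrict (⋃ k, (C k).surf)) :=
    aestronglyMeasurable_iUnion_iff.mpr fun k => h1 (C k)
  rwa [Measure.restrict_eq_self_of_ae_mem] at h3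
  filter_upwards [ae_mem_frontier C hC] with y hy
  obtain ⟨k, hk⟩ := mem_iUnion.mp (hC hy)
  exact mem_iUnion.mpr ⟨k, hy, hk⟩

lemma IsFinitelyCovered.ae_unitNormal (hΩ : IsFinitelyCovered Ω) :
    ∀ᵐ y ∂surfaceMeasure Ω, ‖unitNormal Ω y‖ = 1 := by
  refine hΩ.ae_of_ae_chart fun c => ?_
  filter_upwards [c.ae_differentiableAt, ae_restrict_mem c.isOpen_U.measurableSet] with x hd hx
  rw [c.unitNormal_inv hx hd, c.norm_normal_eq_one]

lemma IsFinitelyCovered.aestronglyMeasurable_unitNormal (hΩ : IsFinitelyCovered Ω) :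
    AEStronglyMeasurable (unitNormal Ω) (surfaceMeasure Ω) := by
  refine hΩ.aestronglyMeasurable fun c => ?_
  refine c.measurable_normal.aestronglyMeasurable.congr ?_
  filter_upwards [c.ae_differentiableAt, ae_restrict_mem c.isOpen_U.measurableSet] with x hd hx
  rw [c.unitNormal_inv hx hd]

lemma IsFinitelyCovered.aestronglyMeasurable_unitNormalK (hΩ : IsFinitelyCovered Ω) (i : Fin 3) :
    AEStronglyMeasurable (fun y => unitNormalK 𝕜 Ω y i) (surfaceMeasure Ω) := by
  have h1 : AEStronglyMeasurable (fun y => unitNormal Ω y i) (surfaceMeasure Ω) :=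
    (EuclideanSpace.proj i : Space →L[ℝ] ℝ).continuous.comp_aestronglyMeasurable
      hΩ.aestronglyMeasurable_unitNormal
  exact RCLike.continuous_ofReal.comp_aestronglyMeasurable h1

lemma norm_unitNormalK_le (y : Space) (i : Fin 3) : ‖unitNormalK 𝕜 Ω y i‖ ≤ 1 := by
  rw [unitNormalK_eq, toK_apply, RCLike.norm_ofReal, ← Real.norm_eq_abs]
  exact (PiLp.norm_apply_le _ _).trans (Chart.norm_unitNormal_le y)

lemma aestronglyMeasurable_apply {μ : Measure Space} {Q : Space → EuclideanSpace 𝕜 (Fin 3)}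
    (hQ : AEStronglyMeasurable Q μ) (i : Fin 3) : AEStronglyMeasurable (fun y => Q y i) μ :=
  (EuclideanSpace.proj i : EuclideanSpace 𝕜 (Fin 3) →L[𝕜] 𝕜).continuous.comp_aestronglyMeasurable hQ

/-- A vector field in `L^∞` given by bounds on its entries. -/
structure IsBoundedField (μ : Measure Space) (Z : Space → EuclideanSpace 𝕜 (Fin 3)) : Prop where
  meas : ∀ i, AEStronglyMeasurable (fun y => Z y i) μ
  bound : ∃ C, ∀ y i, ‖Z y i‖ ≤ C

lemma IsBoundedField.cross {μ : Measure Space} {Z W : Space → EuclideanSpace 𝕜 (Fin 3)}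
    (hZ : IsBoundedField μ Z) (hW : IsBoundedField μ W) :
    IsBoundedField μ fun y => cross (Z y) (W y) where
  meas i := by
    have h (i j : Fin 3) := (hZ.meas i).mul (hW.meas j)
    fin_cases i
    · change AEStronglyMeasurable (fun y => LipschitzBoundary.cross (Z y) (W y) 0) μ
      simp only [cross_zero]
      exact (h 1 2).sub (h 2 1)
    · change AEStronglyMeasurable (fun y => LipschitzBoundary.cross (Z y) (W y) 1) μ
      simp only [cross_one]
      exact (h 2 0).sub (h 0 2)
    · change AEStronglyMeasurable (fun y => LipschitzBoundary.cross (Z y) (W y) 2) μ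
      simp only [cross_two]
      exact (h 0 1).sub (h 1 0)
  bound := by
    obtain ⟨C, hC⟩ := hZ.bound
    obtain ⟨D, hD⟩ := hW.bound
    have h (y : Space) (i j k l : Fin 3) : ‖Z y i * W y j - Z y k * W y l‖ ≤ C * D + C * D := by
      refine (norm_sub_le _ _).trans ?_
      rw [norm_mul, norm_mul]
      have hC0 := (norm_nonneg _).trans (hC y 0)
      exact add_le_add (mul_le_mul (hC y i) (hD y j) (norm_nonneg _) hC0)
        (mul_le_mul (hC y k) (hD y l) (norm_nonneg _) hC0)
    refine ⟨C * D + C * D, fun y i => ?_⟩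
    fin_cases i
    · simpa [cross_zero] using h y 1 2 2 1
    · simpa [cross_one] using h y 2 0 0 2
    · simpa [cross_two] using h y 0 1 1 0

lemma IsBoundedField.dot {μ : Measure Space} {Z W : Space → EuclideanSpace 𝕜 (Fin 3)}
    (hZ : IsBoundedField μ Z) (hW : IsBoundedField μ W) :
    AEStronglyMeasurable (fun y => dot (Z y) (W y)) μ ∧ ∃ C, ∀ y, ‖dot (Z y) (W y)‖ ≤ C := by
  refine ⟨?_, ?_⟩
  · have h (i j : Fin 3) := (hZ.meas i).mul (hW.meas j)
    simp only [dot_eq]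
    exact ((h 0 0).add (h 1 1)).add (h 2 2)
  · obtain ⟨C, hC⟩ := hZ.bound
    obtain ⟨D, hD⟩ := hW.bound
    refine ⟨∑ _ : Fin 3, C * D, fun y => norm_sum_le_of_le _ fun i _ => ?_⟩
    rw [norm_mul]
    exact mul_le_mul (hC y i) (hD y i) (norm_nonneg _) ((norm_nonneg _).trans (hC y i))

lemma IsBoundedField.integrable_inner {μ : Measure Space} {Z d : Space → EuclideanSpace 𝕜 (Fin 3)}
    (hZ : IsBoundedField μ Z) (hd : Integrable d μ) : Integrable (fun y => inner 𝕜 (d y) (Z y)) μ := by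
  obtain ⟨C, hC⟩ := hZ.bound
  have hi (i : Fin 3) : Integrable (fun y => starRingEnd 𝕜 (d y i) * Z y i) μ := by
    have h0 : Integrable (fun y => d y i) μ :=
      (EuclideanSpace.proj i : EuclideanSpace 𝕜 (Fin 3) →L[𝕜] 𝕜).integrable_comp hd
    have h1 : Integrable (fun y => starRingEnd 𝕜 (d y i)) μ :=
      memLp_one_iff_integrable.mp (memLp_one_iff_integrable.mpr h0).star
    exact h1.mul_bdd (hZ.meas i) (Eventually.of_forall fun y => hC y i)
  simp only [inner_eq]
  exact ((hi 0).add (hi 1)).add (hi 2)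

lemma IsBoundedField.aestronglyMeasurable_inner {μ : Measure Space}
    {Z d : Space → EuclideanSpace 𝕜 (Fin 3)} (hZ : IsBoundedField μ Z)
    (hd : AEStronglyMeasurable d μ) : AEStronglyMeasurable (fun y => inner 𝕜 (d y) (Z y)) μ := by
  have hi (i : Fin 3) : AEStronglyMeasurable (fun y => starRingEnd 𝕜 (d y i) * Z y i) μ :=
    (RCLike.continuous_conj.comp_aestronglyMeasurable (aestronglyMeasurable_apply hd i)).mul
      (hZ.meas i)
  simp only [inner_eq]
  exact ((hi 0).add (hi 1)).add (hi 2)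

lemma isBoundedField_of_continuous {μ : Measure Space} {Φ : Space → EuclideanSpace 𝕜 (Fin 3)}
    (hΦ : Continuous Φ) (hc : HasCompactSupport Φ) : IsBoundedField μ Φ where
  meas i := aestronglyMeasurable_apply hΦ.aestronglyMeasurable i
  bound := by
    obtain ⟨C, hC⟩ := hΦ.bounded_above_of_compact_support hc
    exact ⟨C, fun y i => (PiLp.norm_apply_le _ _).trans (hC y)⟩

lemma IsFinitelyCovered.isBoundedField_unitNormalK (hΩ : IsFinitelyCovered Ω) :
    IsBoundedField (surfaceMeasure Ω) (unitNormalK 𝕜 Ω) :=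
  ⟨hΩ.aestronglyMeasurable_unitNormalK, 1, norm_unitNormalK_le⟩

lemma rot_eq_zero {Φ : Space → EuclideanSpace 𝕜 (Fin 3)} {y : Space} (hy : y ∉ tsupport Φ) :
    rot Φ y = 0 := by
  have : fderiv ℝ Φ y = 0 := fderiv_of_notMem_tsupport ℝ hy
  ext i
  fin_cases i <;> simp [rot, partialDeriv, this]

lemma continuous_rot {Φ : Space → EuclideanSpace 𝕜 (Fin 3)} (hΦ : ContDiff ℝ ∞ Φ) :
    Continuous (rot Φ) := by
  have h1 := hΦ.continuous_fderiv (by simp)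
  have h2 (i j : Fin 3) : Continuous (partialDeriv Φ j i) := by
    unfold partialDeriv
    exact (EuclideanSpace.proj i : EuclideanSpace 𝕜 (Fin 3) →L[𝕜] 𝕜).continuous.comp
      (h1.clm_apply continuous_const)
  refine (PiLp.continuous_toLp 2 _).comp (continuous_pi fun i => ?_)
  fin_cases i
  · exact (h2 2 1).sub (h2 1 2)
  · exact (h2 0 2).sub (h2 2 0)
  · exact (h2 1 0).sub (h2 0 1)

lemma hasCompactSupport_rot {Φ : Space → EuclideanSpace 𝕜 (Fin 3)} (hc : HasCompactSupport Φ) :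
    HasCompactSupport (rot Φ) :=
  HasCompactSupport.of_support_subset_isCompact hc fun y hy => by
    by_contra h
    exact hy (rot_eq_zero h)

lemma IsFinitelyCovered.isBoundedField_cross (hΩ : IsFinitelyCovered Ω)
    {Φ : Space → EuclideanSpace 𝕜 (Fin 3)} (hΦ : ContDiff ℝ ∞ Φ) (hc : HasCompactSupport Φ) :
    IsBoundedField (surfaceMeasure Ω) fun y => LipschitzBoundary.cross (unitNormalK 𝕜 Ω y) (Φ y) :=
  hΩ.isBoundedField_unitNormalK.cross (isBoundedField_of_continuous hΦ.continuous hc)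

lemma IsFinitelyCovered.isBounded_dot_rot (hΩ : IsFinitelyCovered Ω)
    {Φ : Space → EuclideanSpace 𝕜 (Fin 3)} (hΦ : ContDiff ℝ ∞ Φ) (hc : HasCompactSupport Φ) :
    AEStronglyMeasurable (fun y => dot (unitNormalK 𝕜 Ω y) (rot Φ y)) (surfaceMeasure Ω) ∧
      ∃ C, ∀ y, ‖dot (unitNormalK 𝕜 Ω y) (rot Φ y)‖ ≤ C :=
  hΩ.isBoundedField_unitNormalK.dot
    (isBoundedField_of_continuous (continuous_rot hΦ) (hasCompactSupport_rot hc))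

/-- Integration by parts on the boundary with test fields supported in a chart. -/
lemma Chart.integral_surface (c : Chart Ω) (hΩ : IsFinitelyCovered Ω) {F : Space → 𝕜}
    {Q : Space → EuclideanSpace 𝕜 (Fin 3)} (hF : AEStronglyMeasurable F (surfaceMeasure Ω))
    (hQ : AEStronglyMeasurable Q (surfaceMeasure Ω)) {G : Plane → EuclideanSpace 𝕜 (Fin 2)}
    (h : HasSobolevGradient c.U (fun x => F (c.inv x)) G)
    (hQG : ∀ᵐ x ∂volume.restrict c.U, Q (c.inv x) = c.liftGradient x (G x))
    {Φ : Space → EuclideanSpace 𝕜 (Fin 3)} (hΦ : ContDiff ℝ ∞ Φ)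
    (hc : HasCompactSupport Φ) (hs : tsupport Φ ⊆ c.dom) :
    ∫ y, inner 𝕜 (Q y) (cross (unitNormalK 𝕜 Ω y) (Φ y)) ∂surfaceMeasure Ω =
      ∫ y, inner 𝕜 (F y) (dot (unitNormalK 𝕜 Ω y) (rot Φ y)) ∂surfaceMeasure Ω := by
  obtain ⟨N, C, hC⟩ := id hΩ
  -- The measure lives on ∂Ω, which meets `c.dom` exactly in `c.surf`; both integrals thus reduce to
  -- the chart domain.
  have hoff : ∀ᵐ y ∂surfaceMeasure Ω, y ∉ c.surf → y ∉ tsupport Φ := by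
    filter_upwards [ae_mem_frontier C hC] with y hy hys hyt
    exact hys ⟨hy, hs hyt⟩
  have e1 : ∀ᵐ y ∂surfaceMeasure Ω, y ∉ c.surf →
      inner 𝕜 (Q y) (cross (unitNormalK 𝕜 Ω y) (Φ y)) = 0 := by
    filter_upwards [hoff] with y hy hys
    simp [image_eq_zero_of_notMem_tsupport (hy hys), cross]
  have e2 : ∀ᵐ y ∂surfaceMeasure Ω, y ∉ c.surf →
      inner 𝕜 (F y) (dot (unitNormalK 𝕜 Ω y) (rot Φ y)) = 0 := by
    filter_upwards [hoff] with y hy hys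
    simp [rot_eq_zero (hy hys), dot]
  have m1 := (hΩ.isBoundedField_cross hΦ hc).aestronglyMeasurable_inner hQ
  have m2 : AEStronglyMeasurable (fun y => inner 𝕜 (F y) (dot (unitNormalK 𝕜 Ω y) (rot Φ y)))
      (surfaceMeasure Ω) := hF.inner (hΩ.isBounded_dot_rot hΦ hc).1
  rw [← setIntegral_eq_integral_of_ae_compl_eq_zero e1,
    ← setIntegral_eq_integral_of_ae_compl_eq_zero e2, Chart.setIntegral_surf hΩ m1,
    Chart.setIntegral_surf hΩ m2]
  have h1 := c.integral_chart h hΦ hc hs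
  have hν : ∀ᵐ x ∂volume.restrict c.U, unitNormalK 𝕜 Ω (c.inv x) = toK 𝕜 (c.normal x) := by
    filter_upwards [c.ae_differentiableAt, ae_restrict_mem c.isOpen_U.measurableSet] with x hd hx
    rw [unitNormalK_eq, c.unitNormal_inv hx hd]
  calc _ = _ := integral_congr_ae (by filter_upwards [hν, hQG] with x hx hq; rw [hx, hq])
    _ = _ := h1
    _ = _ := integral_congr_ae (by filter_upwards [hν] with x hx; rw [hx])

/-! ### Uniqueness of tangential fields -/

/-- The pairings with n × e_j say that d × n = 0, and d = (n · d) n − n × (n × d) for a unit vector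
n. -/
lemma eq_zero_of_dot_cross_eq_zero {n : Space} (hn : ‖n‖ = 1) {d : EuclideanSpace 𝕜 (Fin 3)}
    (h0 : dot (toK 𝕜 n) d = 0)
    (h : ∀ j, inner 𝕜 d (cross (toK 𝕜 n) (EuclideanSpace.single j 1)) = 0) : d = 0 := by
  have hn2 : (n 0 : 𝕜) * n 0 + (n 1 : 𝕜) * n 1 + (n 2 : 𝕜) * n 2 = 1 := by
    have := EuclideanSpace.real_norm_sq_eq n
    rw [hn, Fin.sum_univ_three] at this
    have h2 : n 0 * n 0 + n 1 * n 1 + n 2 * n 2 = 1 := by linarith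
    simpa using congrArg (fun r : ℝ => (r : 𝕜)) h2
  have hc (j : Fin 3) := congrArg (starRingEnd 𝕜) (h j)
  simp only [inner_eq, cross_zero, cross_one, cross_two, toK_apply, map_add, map_mul, map_sub,
    RCLike.conj_ofReal, RCLike.conj_conj, map_zero] at hc
  have c0 := hc 0
  have c1 := hc 1
  have c2 := hc 2
  simp at c0 c1 c2
  simp only [dot_eq, toK_apply] at h0
  ext i
  fin_cases i
  · change d 0 = 0
    linear_combination (-d 0) * hn2 + (n 0 : 𝕜) * h0 - (n 2 : 𝕜) * c1 + (n 1 : 𝕜) * c2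
  · change d 1 = 0
    linear_combination (-d 1) * hn2 + (n 1 : 𝕜) * h0 - (n 0 : 𝕜) * c2 + (n 2 : 𝕜) * c0
  · change d 2 = 0
    linear_combination (-d 2) * hn2 + (n 2 : 𝕜) * h0 - (n 1 : 𝕜) * c0 + (n 0 : 𝕜) * c1

/-- A tangential field is determined by its pairing with `ν × Φ`. -/
lemma IsFinitelyCovered.ae_eq_zero (hΩ : IsFinitelyCovered Ω)
    {d : Space → EuclideanSpace 𝕜 (Fin 3)} (hd : Integrable d (surfaceMeasure Ω)) {W : Set Space}
    (hW : IsOpen W) (ht : ∀ᵐ y ∂surfaceMeasure Ω, dot (unitNormalK 𝕜 Ω y) (d y) = 0)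
    (h : ∀ Φ : Space → EuclideanSpace 𝕜 (Fin 3), ContDiff ℝ ∞ Φ → HasCompactSupport Φ →
      tsupport Φ ⊆ W →
      ∫ y, inner 𝕜 (d y) (cross (unitNormalK 𝕜 Ω y) (Φ y)) ∂surfaceMeasure Ω = 0) :
    ∀ᵐ y ∂surfaceMeasure Ω, y ∈ W → d y = 0 := by
  have hconst (j : Fin 3) : IsBoundedField (surfaceMeasure Ω)
      fun _ => (EuclideanSpace.single j 1 : EuclideanSpace 𝕜 (Fin 3)) :=
    ⟨fun i => aestronglyMeasurable_const, 1, fun y i => (PiLp.norm_apply_le _ _).trans (by simp)⟩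
  have hj (j : Fin 3) : ∀ᵐ y ∂surfaceMeasure Ω, y ∈ W → inner 𝕜 (d y)
      (cross (unitNormalK 𝕜 Ω y) (EuclideanSpace.single j 1)) = 0 := by
    have hint : Integrable (fun y => inner 𝕜 (d y)
        (cross (unitNormalK 𝕜 Ω y) (EuclideanSpace.single j 1))) (surfaceMeasure Ω) :=
      (hΩ.isBoundedField_unitNormalK.cross (hconst j)).integrable_inner hd
    -- The fundamental lemma of the calculus of variations with respect to the surface measure,
    -- using the test fields g e_j with scalar g.
    refine hW.ae_eq_zero_of_integral_contDiff_smul_eq_zero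
      (hint.locallyIntegrable.locallyIntegrableOn _) fun g hg hgc hgW => ?_
    have hs : Function.support (fun y => g y • (EuclideanSpace.single j 1 : EuclideanSpace 𝕜 (Fin 3)))
        ⊆ Function.support g := fun y hy hg0 => hy (by simp [hg0])
    have := h (fun y => g y • (EuclideanSpace.single j 1 : EuclideanSpace 𝕜 (Fin 3)))
      (hg.smul contDiff_const) (HasCompactSupport.of_support_subset_isCompact hgc
        (hs.trans (subset_tsupport _))) ((closure_mono hs).trans hgW)
    rw [← this]
    refine integral_congr_ae (Eventually.of_forall fun y => ?_)
    simp only [inner_eq, cross_zero, cross_one, cross_two, RCLike.real_smul_eq_coe_mul,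
      PiLp.smul_apply]
    ring
  filter_upwards [hΩ.ae_unitNormal, ht, ae_all_iff.mpr hj] with y h1 h2 h3 hy
  exact eq_zero_of_dot_cross_eq_zero h1 h2 fun j => h3 j hy

end

section

variable {𝕜 : Type*} [RCLike 𝕜] {Ω : Set Space}

/-- Two tangential fields with the same pairing with `ν × Φ` agree. -/
lemma IsFinitelyCovered.ae_eq_of_pairing_eq (hΩ : IsFinitelyCovered Ω)
    {Q Q' : Space → EuclideanSpace 𝕜 (Fin 3)} (hQ : Integrable Q (surfaceMeasure Ω))
    (hQ' : Integrable Q' (surfaceMeasure Ω)) {W : Set Space} (hW : IsOpen W)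
    (ht : ∀ᵐ y ∂surfaceMeasure Ω, dot (unitNormalK 𝕜 Ω y) (Q y) = 0)
    (ht' : ∀ᵐ y ∂surfaceMeasure Ω, dot (unitNormalK 𝕜 Ω y) (Q' y) = 0)
    (h : ∀ Φ : Space → EuclideanSpace 𝕜 (Fin 3), ContDiff ℝ ∞ Φ → HasCompactSupport Φ →
      tsupport Φ ⊆ W →
      ∫ y, inner 𝕜 (Q y) (cross (unitNormalK 𝕜 Ω y) (Φ y)) ∂surfaceMeasure Ω =
        ∫ y, inner 𝕜 (Q' y) (cross (unitNormalK 𝕜 Ω y) (Φ y)) ∂surfaceMeasure Ω) :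
    ∀ᵐ y ∂surfaceMeasure Ω, y ∈ W → Q y = Q' y := by
  have key := hΩ.ae_eq_zero (hQ.sub hQ') hW ?_ fun Φ hΦ hc hs => ?_
  · filter_upwards [key] with y hy hyW
    exact sub_eq_zero.mp (hy hyW)
  · filter_upwards [ht, ht'] with y h1 h2
    have : dot (unitNormalK 𝕜 Ω y) ((Q - Q') y) =
        dot (unitNormalK 𝕜 Ω y) (Q y) - dot (unitNormalK 𝕜 Ω y) (Q' y) := by
      simp [dot_eq]
      ring
    rw [this, h1, h2, sub_zero]
  · have hb := hΩ.isBoundedField_cross hΦ hc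
    simp only [Pi.sub_apply, inner_sub_left]
    rw [integral_sub (hb.integrable_inner hQ) (hb.integrable_inner hQ'), h Φ hΦ hc hs, sub_self]

lemma L2Vec.integrable (hΩ : IsFinitelyCovered Ω) (q : L2Vec 𝕜 Ω) :
    Integrable q (surfaceMeasure Ω) := by
  have := hΩ.isFiniteMeasure
  exact (Lp.memLp q).integrable one_le_two

lemma L2.integrable (hΩ : IsFinitelyCovered Ω) (f : L2 𝕜 Ω) :
    Integrable f (surfaceMeasure Ω) := by
  have := hΩ.isFiniteMeasure
  exact (Lp.memLp f).integrable one_le_two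

/-- The weak tangential gradient is unique. -/
lemma IsWeakTangentialGradient.unique (hΩ : IsFinitelyCovered Ω) {f : L2 𝕜 Ω} {q q' : L2Vec 𝕜 Ω}
    (h : IsWeakTangentialGradient f q) (h' : IsWeakTangentialGradient f q') : q = q' := by
  have := hΩ.ae_eq_of_pairing_eq (L2Vec.integrable hΩ q) (L2Vec.integrable hΩ q') isOpen_univ
    h.1 h'.1 fun Φ hΦ hc _ => (h.2 Φ hΦ hc).trans (h'.2 Φ hΦ hc).symm
  refine Lp.ext ?_
  filter_upwards [this] with y hy using hy (mem_univ y)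

/-! ### The chart gradient is a weak gradient -/

lemma inner_cross_sum {ι : Type*} (s : Finset ι) (Q n : EuclideanSpace 𝕜 (Fin 3))
    (Z : ι → EuclideanSpace 𝕜 (Fin 3)) :
    inner 𝕜 Q (cross n (∑ k ∈ s, Z k)) = ∑ k ∈ s, inner 𝕜 Q (cross n (Z k)) :=
  map_sum (AddMonoidHom.mk' (fun Z => inner 𝕜 Q (cross n Z)) fun a b => by
    simp only [inner_eq, cross_zero, cross_one, cross_two, PiLp.add_apply]
    ring) Z s

lemma inner_dot_sum {ι : Type*} (s : Finset ι) (a : 𝕜) (n : EuclideanSpace 𝕜 (Fin 3))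
    (Z : ι → EuclideanSpace 𝕜 (Fin 3)) :
    inner 𝕜 a (dot n (∑ k ∈ s, Z k)) = ∑ k ∈ s, inner 𝕜 a (dot n (Z k)) :=
  map_sum (AddMonoidHom.mk' (fun Z => inner 𝕜 a (dot n Z)) fun a b => by
    simp only [dot_eq, PiLp.add_apply, RCLike.inner_apply]
    ring) Z s

lemma rot_congr {Φ Ψ : Space → EuclideanSpace 𝕜 (Fin 3)} {y : Space} (h : Φ =ᶠ[𝓝 y] Ψ) :
    rot Φ y = rot Ψ y := by
  simp only [rot, partialDeriv, h.fderiv_eq]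

lemma rot_sum {ι : Type*} (s : Finset ι) {Φ : ι → Space → EuclideanSpace 𝕜 (Fin 3)} {y : Space}
    (h : ∀ k, DifferentiableAt ℝ (Φ k) y) :
    rot (fun z => ∑ k ∈ s, Φ k z) y = ∑ k ∈ s, rot (Φ k) y := by
  have hp (j i : Fin 3) : partialDeriv (fun z => ∑ k ∈ s, Φ k z) j i y =
      ∑ k ∈ s, partialDeriv (Φ k) j i y := by
    simp only [partialDeriv]
    rw [fderiv_fun_sum fun k _ => h k]
    simp
  ext i
  rw [WithLp.ofLp_sum, Finset.sum_apply]
  fin_cases i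
  · change rot _ y 0 = ∑ k ∈ s, rot (Φ k) y 0
    simp only [rot_zero, hp, Finset.sum_sub_distrib]
  · change rot _ y 1 = ∑ k ∈ s, rot (Φ k) y 1
    simp only [rot_one, hp, Finset.sum_sub_distrib]
  · change rot _ y 2 = ∑ k ∈ s, rot (Φ k) y 2
    simp only [rot_two, hp, Finset.sum_sub_distrib]

/-- The sum has to be one on a neighbourhood of each point of `S`, because rot differentiates it.
The partition is therefore subordinate over a closed thickening of `S`. -/
lemma exists_partition {N : ℕ} {W : Fin N → Set Space} (hW : ∀ k, IsOpen (W k)) {S : Set Space}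
    (hS : IsCompact S) (hSW : S ⊆ ⋃ k, W k) :
    ∃ χ : Fin N → Space → ℝ, (∀ k, ContDiff ℝ ∞ (χ k)) ∧ (∀ k, tsupport (χ k) ⊆ W k) ∧
      ∀ y ∈ S, ∀ᶠ z in 𝓝 y, ∑ k, χ k z = 1 := by
  obtain ⟨δ, hδ, hδW⟩ := hS.exists_cthickening_subset_open (isOpen_iUnion hW) hSW
  obtain ⟨χ, hχ⟩ := SmoothPartitionOfUnity.exists_isSubordinate 𝓘(ℝ, Space)
    (Metric.isClosed_cthickening (E := S) (δ := δ)) W hW hδW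
  refine ⟨fun k => χ k, fun k => (χ k).contMDiff.contDiff, hχ, fun y hy => ?_⟩
  have hn : Metric.cthickening δ S ∈ 𝓝 y :=
    mem_of_superset (Metric.isOpen_thickening.mem_nhds (Metric.self_subset_thickening hδ S hy))
      (Metric.thickening_subset_cthickening δ S)
  filter_upwards [hn] with z hz
  rw [← finsum_eq_sum_of_fintype]
  exact χ.sum_eq_one hz

/-- Tangentiality is the orthogonality of lifted gradients to the normal. For the pairing, Φ is
split by a partition of unity into fields supported in single charts; near ∂Ω these add up to Φ,
hence so do their rotations. -/
lemma IsTangentialGradient.isWeakTangentialGradient (hΩ : IsFinitelyCovered Ω)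
    (hcompact : IsCompact (frontier Ω)) {f : L2 𝕜 Ω} {q : L2Vec 𝕜 Ω}
    (h : IsTangentialGradient f q) : IsWeakTangentialGradient f q := by
  refine ⟨hΩ.ae_of_ae_chart fun c => ?_, fun Φ hΦ hc => ?_⟩
  · obtain ⟨G, -, hq⟩ := h c
    filter_upwards [hq, c.ae_differentiableAt, ae_restrict_mem c.isOpen_U.measurableSet]
      with x hx hd hU
    rw [hx, unitNormalK_eq, c.unitNormal_inv hU hd, c.dot_normal_liftGradient hd]
  · obtain ⟨N, C, hC⟩ := id hΩ
    obtain ⟨χ, hχ, hχW, hχ1⟩ := exists_partition (fun k => (C k).isOpen_dom) hcompact hC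
    set Ψ : Fin N → Space → EuclideanSpace 𝕜 (Fin 3) := fun k y => χ k y • Φ y with hΨ
    have hΨs (k : Fin N) : ContDiff ℝ ∞ (Ψ k) := (hχ k).smul hΦ
    have hΨsub (k : Fin N) : Function.support (Ψ k) ⊆ Function.support Φ :=
      fun y hy h0 => hy (by simp [hΨ, h0])
    have hΨc (k : Fin N) : HasCompactSupport (Ψ k) :=
      HasCompactSupport.of_support_subset_isCompact hc ((hΨsub k).trans (subset_tsupport _))
    have hΨsub' (k : Fin N) : Function.support (Ψ k) ⊆ Function.support (χ k) :=
      fun y hy h0 => hy (by simp [hΨ, h0])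
    have hΨW (k : Fin N) : tsupport (Ψ k) ⊆ (C k).dom :=
      (closure_mono (hΨsub' k)).trans (hχW k)
    have hsum : ∀ y ∈ frontier Ω, Φ =ᶠ[𝓝 y] fun z => ∑ k, Ψ k z := by
      intro y hy
      filter_upwards [hχ1 y hy] with z hz
      simp only [hΨ]
      rw [← Finset.sum_smul, hz, one_smul]
    have hrot : ∀ y ∈ frontier Ω, rot Φ y = ∑ k, rot (Ψ k) y := by
      intro y hy
      rw [rot_congr (hsum y hy), rot_sum _ fun k => ((hΨs k).differentiable (by simp)) y]
    have hloc (k : Fin N) :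
        ∫ y, inner 𝕜 (q y) (cross (unitNormalK 𝕜 Ω y) (Ψ k y)) ∂surfaceMeasure Ω =
        ∫ y, inner 𝕜 (f y) (dot (unitNormalK 𝕜 Ω y) (rot (Ψ k) y)) ∂surfaceMeasure Ω := by
      obtain ⟨G, hG, hq⟩ := h (C k)
      exact (C k).integral_surface hΩ (Lp.aestronglyMeasurable f) (Lp.aestronglyMeasurable q) hG hq
        (hΨs k) (hΨc k) (hΨW k)
    have hintR (k : Fin N) : Integrable
        (fun y => inner 𝕜 (f y) (dot (unitNormalK 𝕜 Ω y) (rot (Ψ k) y))) (surfaceMeasure Ω) := by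
      obtain ⟨m, D, hD⟩ := hΩ.isBounded_dot_rot (hΨs k) (hΨc k)
      have h1 : Integrable (fun y => starRingEnd 𝕜 (f y)) (surfaceMeasure Ω) :=
        memLp_one_iff_integrable.mp (memLp_one_iff_integrable.mpr (L2.integrable hΩ f)).star
      simp only [RCLike.inner_apply]
      exact h1.bdd_mul m (Eventually.of_forall hD)
    calc _ = ∫ y, ∑ k, inner 𝕜 (q y) (cross (unitNormalK 𝕜 Ω y) (Ψ k y)) ∂surfaceMeasure Ω := by
          refine integral_congr_ae ?_
          filter_upwards [ae_mem_frontier C hC] with y hy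
          rw [(hsum y hy).eq_of_nhds, inner_cross_sum]
      _ = ∫ y, ∑ k, inner 𝕜 (f y) (dot (unitNormalK 𝕜 Ω y) (rot (Ψ k) y)) ∂surfaceMeasure Ω := by
          rw [integral_finsetSum _ fun k _ => (hΩ.isBoundedField_cross (hΨs k)
            (hΨc k)).integrable_inner (L2Vec.integrable hΩ q),
            integral_finsetSum _ fun k _ => hintR k]
          exact Finset.sum_congr rfl fun k _ => hloc k
      _ = _ := by
          refine integral_congr_ae ?_
          filter_upwards [ae_mem_frontier C hC] with y hy
          rw [hrot y hy, inner_dot_sum]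

/-! ### Existence of the chart gradient -/

namespace Chart

variable (c : Chart Ω)

/-- The tangential field on a chart domain with a given gradient in the parameter plane. -/
def lifted (G : Plane → EuclideanSpace 𝕜 (Fin 2)) : Space → EuclideanSpace 𝕜 (Fin 3) :=
  c.surf.indicator fun y => c.liftGradient (c.coords y) (G (c.coords y))

lemma lifted_inv (G : Plane → EuclideanSpace 𝕜 (Fin 2)) {x : Plane} (hx : x ∈ c.U) :
    c.lifted G (c.inv x) = c.liftGradient x (G x) := by
  rw [lifted, indicator_of_mem (c.inv_mem_surf hx), coords_inv]

lemma planeMeasure_le : c.planeMeasure ≤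
    ENNReal.ofReal (Real.sqrt (1 + 2 * (c.lip : ℝ) ^ 2)) • volume.restrict c.U := by
  rw [planeMeasure, ← withDensity_const]
  refine withDensity_mono ?_
  filter_upwards [c.ae_differentiableAt, ae_restrict_mem c.isOpen_U.measurableSet] with x hd hx
  exact ENNReal.ofReal_le_ofReal (c.areaElement_le hx hd)

/-- The pseudoinverse and the area element are both bounded, so square integrability passes from the
parameter set to the surface. -/
lemma memLp_lifted (hΩ : IsFinitelyCovered Ω) {G : Plane → EuclideanSpace 𝕜 (Fin 2)}
    (hG : MemLp G 2 (volume.restrict c.U)) : MemLp (c.lifted G) 2 (surfaceMeasure Ω) := by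
  obtain ⟨N, C, hC⟩ := hΩ
  rw [lifted, memLp_indicator_iff_restrict c.measurableSet_surf,
    surfaceMeasure_restrict_surf C hC c]
  have h1 : MemLp (fun x => c.liftGradient x (G x)) 2 c.planeMeasure :=
    (c.memLp_liftGradient hG).of_measure_le_smul ENNReal.ofReal_ne_top c.planeMeasure_le
  rw [← c.map_coords] at h1
  exact h1.comp_of_map c.continuous_coords.aemeasurable

lemma lifted_tangential (hΩ : IsFinitelyCovered Ω) (G : Plane → EuclideanSpace 𝕜 (Fin 2)) :
    ∀ᵐ y ∂surfaceMeasure Ω, dot (unitNormalK 𝕜 Ω y) (c.lifted G y) = 0 := by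
  have h1 : ∀ᵐ x ∂volume.restrict c.U,
      dot (unitNormalK 𝕜 Ω (c.inv x)) (c.lifted G (c.inv x)) = 0 := by
    filter_upwards [c.ae_differentiableAt, ae_restrict_mem c.isOpen_U.measurableSet] with x hd hx
    rw [c.lifted_inv G hx, unitNormalK_eq, c.unitNormal_inv hx hd, c.dot_normal_liftGradient hd]
  filter_upwards [ae_surf (P := fun y => dot (unitNormalK 𝕜 Ω y) (c.lifted G y) = 0) hΩ h1]
    with y hy
  by_cases hs : y ∈ c.surf
  · exact hy hs
  · rw [lifted, indicator_of_notMem hs]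
    simp [dot]

/-- For test fields supported over both cylinder parts, either lift has the same pairing with ν × Φ,
namely that of f with ν · rot Φ. Local uniqueness of tangential fields then gives equality on the
overlap. -/
lemma ae_lifted_eq (hΩ : IsFinitelyCovered Ω) (f : L2 𝕜 Ω) (c c' : Chart Ω)
    {G G' : Plane → EuclideanSpace 𝕜 (Fin 2)}
    (h : HasSobolevGradient c.U (fun x => f (c.inv x)) G)
    (h' : HasSobolevGradient c'.U (fun x => f (c'.inv x)) G') :
    ∀ᵐ y ∂surfaceMeasure Ω, y ∈ c.surf → y ∈ c'.surf → c.lifted G y = c'.lifted G' y := by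
  have := hΩ.isFiniteMeasure
  have m := c.memLp_lifted hΩ h.memLp_gradient
  have m' := c'.memLp_lifted hΩ h'.memLp_gradient
  have e (c : Chart Ω) (G : Plane → EuclideanSpace 𝕜 (Fin 2)) :
      ∀ᵐ x ∂volume.restrict c.U, c.lifted G (c.inv x) = c.liftGradient x (G x) := by
    filter_upwards [ae_restrict_mem c.isOpen_U.measurableSet] with x hx using c.lifted_inv G hx
  have key := hΩ.ae_eq_of_pairing_eq (m.integrable one_le_two) (m'.integrable one_le_two)
    (c.isOpen_dom.inter c'.isOpen_dom) (c.lifted_tangential hΩ G) (c'.lifted_tangential hΩ G')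
    fun Φ hΦ hc hs => (c.integral_surface hΩ (Lp.aestronglyMeasurable f) m.1 h (e c G) hΦ hc
      (hs.trans inter_subset_left)).trans (c'.integral_surface hΩ (Lp.aestronglyMeasurable f) m'.1
        h' (e c' G') hΦ hc (hs.trans inter_subset_right)).symm
  filter_upwards [key] with y hy h1 h2 using hy ⟨h1.2, h2.2⟩

end Chart

/-- Finitely many lifts are assembled along disjoint pieces. The result has the correct form in
every chart, not only those of the cover, since any two lifts agree on overlaps. -/
lemma exists_isTangentialGradient (hΩ : IsFinitelyCovered Ω) {f : L2 𝕜 Ω} (hf : f ∈ H1 𝕜 Ω) :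
    ∃ q : L2Vec 𝕜 Ω, IsTangentialGradient f q := by
  choose G hG using hf
  obtain ⟨N, C, hC⟩ := id hΩ
  set Q : Space → EuclideanSpace 𝕜 (Fin 3) := fun y =>
    ∑ k, (piece C k).indicator ((C k).lifted (G (C k))) y with hQ
  have hm : MemLp Q 2 (surfaceMeasure Ω) := memLp_finsetSum _ fun k _ =>
    ((C k).memLp_lifted hΩ (hG (C k)).memLp_gradient).indicator (measurableSet_piece C k)
  refine ⟨hm.toLp Q, fun c => ⟨G c, hG c, ?_⟩⟩
  have h1 : ∀ᵐ y ∂surfaceMeasure Ω, y ∈ c.surf → hm.toLp Q y = c.lifted (G c) y := by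
    filter_upwards [hm.coeFn_toLp, ae_mem_frontier C hC,
      ae_all_iff.mpr fun k => Chart.ae_lifted_eq hΩ f (C k) c (hG (C k)) (hG c)] with y h1 h2 h3 hy
    rw [← iUnion_piece C hC] at h2
    obtain ⟨k, hk⟩ := mem_iUnion.mp h2
    rw [h1, ← h3 k (piece_subset C k hk) hy, hQ]
    simp only
    rw [Finset.sum_eq_single k, indicator_of_mem hk]
    · intro j _ hj
      exact indicator_of_notMem (fun hj' => disjoint_left.mp (pairwise_disjoint_piece C hj) hj' hk) _
    · simp
  filter_upwards [Chart.ae_inv (P := fun y => y ∈ c.surf → hm.toLp Q y = c.lifted (G c) y) hΩ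
    (h1.mono fun y hy _ => hy), ae_restrict_mem c.isOpen_U.measurableSet] with x hx hU
  rw [hx (c.inv_mem_surf hU), c.lifted_inv _ hU]

end

end LipschitzBoundary

end

theorem mainTheorem3 (𝕜 : Type*) [RCLike 𝕜] (Ω : Set LipschitzBoundary.Space)
    (hΩ : LipschitzBoundary.IsStrongLipschitzDomain Ω) (hcompact : IsCompact (frontier Ω)) :
    LipschitzBoundary.H1 𝕜 Ω ⊆ LipschitzBoundary.weakH1 𝕜 Ω ∧
    ∀ f ∈ LipschitzBoundary.H1 𝕜 Ω, ∃ q : LipschitzBoundary.L2Vec 𝕜 Ω,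
      (∀ g, LipschitzBoundary.IsTangentialGradient f g ↔ g = q) ∧
      (∀ g, LipschitzBoundary.IsWeakTangentialGradient f g ↔ g = q) := by
  have hcov : LipschitzBoundary.IsFinitelyCovered Ω :=
    LipschitzBoundary.exists_finite_cover hΩ hcompact
  refine ⟨fun f hf => ?_, fun f hf => ?_⟩
  · obtain ⟨q, hq⟩ := LipschitzBoundary.exists_isTangentialGradient hcov hf
    exact ⟨q, hq.isWeakTangentialGradient hcov hcompact⟩
  · obtain ⟨q, hq⟩ := LipschitzBoundary.exists_isTangentialGradient hcov hf
    have hw := hq.isWeakTangentialGradient hcov hcompact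
    refine ⟨q, fun g => ⟨fun hg => ?_, fun hg => hg ▸ hq⟩, fun g => ⟨fun hg => ?_, fun hg => hg ▸ hw⟩⟩
    -- Uniqueness of the chart gradient is inherited from the weak one.
    · exact (hg.isWeakTangentialGradient hcov hcompact).unique hcov hw
    · exact hg.unique hcov hw
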